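/- Let $H_0$ be a real separable Hilbert space with an orthonormal basis $(e_n)_{n\ge 1}$, and let $1<\lambda_1<\lambda_2<\cdots$ satisfy $\sum_n\lambda_n^{-2}<\infty$. For $p\ge 0$ put $H_p=\{x\in H_0:|x|_p^2:=\sum_n\lambda_n^{2p}\langle x,e_n\rangle^2<\infty\}$ and $\mathcal H=\bigcap_p H_p$, with the topology given by the norms $|\cdot|_p$. Let $\mathcal H'$ be the dual of $\mathcal H$ with its strong topology and with the $\sigma$-algebra generated by the maps $x\mapsto\langle x,y\rangle$, $y\in\mathcal H$; each $a\in H_0$ is regarded as the element $y\mapsto\langle a,y\rangle$ of $\mathcal H'$. The white noise measure $\mu$ is the unique probability measure on $\mathcal H'$ with $\int e^{i\langle x,y\rangle}\,d\mu(x)=e^{-\frac12|y|_0^2}$ for all $y\in\mathcal H$. For $a\in H_0$ and a linear subspace $V$ of $H_0$, the Gaussian measure $\mu_{a+V}$ is the unique probability measure on $\mathcal H'$ with $$\int_{\mathcal H'}e^{i\langle x,y\rangle}\,d\mu_{a+V}(x)=e^{i\langle a,y\rangle-\frac12\langle y_V,y_V\rangle}\qquad(y\in\mathcal H),$$ where $y_V$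 is the orthogonal projection of $y$ onto (the closure of) $V$; write $\mu_V=\mu_{0+V}$. Let $\mathcal F_s(H_p)_c$ be the complexified symmetric Fock space over $H_p$, with squared norm $\sum_n n!\,|f_n|^2_{H_p^{\otimes n}}$, and let $I:\mathcal F_s(H_0)_c\to L^2(\mathcal H',\mu)$ be the Wiener–Itô isomorphism, the continuous linear map that sends $\sum_n\frac1{n!}x^{\otimes n}$ to $e^{\langle\cdot,x\rangle-\frac12|x|_0^2}$ for every $x\in\mathcal H$. The space $[\mathcal H]$ of test functions consists of the continuous functions $\phi:\mathcal H'\to\mathbb C$ whose $\mu$-class lies in $I(\mathcal F_s(H_p)_c)$ for every $p\ge 0$. Theorem. The measures $\mu$, $\mu_{a+V}$ and $\mu_V$ exist and are unique, and if $V$ is a subspace of $H_0$ and $a\in V^\perp$, then for every $\phi\in[\mathcal H]$ the function $\phi$ is $\mu_{a+V}$-integrable, the function $x\mapsto\phi(x+a)$ is $\mu_V$-integrable, and $$\int_{\mathcal H'}\phi(x)\,d\mu_{a+V}(x)=\int_{\mathcal H'}\phi(x+a)\,d\mu_V(x).$$ -/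

import Mathlib

open MeasureTheory
open scoped ENNReal

noncomputable section

/-- The data of white noise analysis over a real Hilbert space `E` (the space `H₀`): an orthonormal
basis `e` of eigenvectors of the positive operator `A e_n = ev n • e_n`, where
`1 < ev 0 < ev 1 < ⋯` and `∑ (ev n)⁻² < ∞`. (So `E` is separable and infinite-dimensional.) -/
structure WhiteNoise (E : Type*) [NormedAddCommGroup E] [InnerProductSpace ℝ E] where
  e : HilbertBasis ℕ ℝ E
  ev : ℕ → ℝ
  one_lt_ev : ∀ n, 1 < ev n
  ev_strictMono : StrictMono ev
  summable_ev : Summable fun n => (ev n ^ 2)⁻¹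

namespace WhiteNoise

variable {E : Type*} [NormedAddCommGroup E] [InnerProductSpace ℝ E] (S : WhiteNoise E)

/-! ### The nuclear space and its dual -/

/-- `H_p = {x ∈ H₀ : ∑ₙ λₙ^{2p} ⟨x, eₙ⟩² < ∞}`. -/
def Hp (p : ℕ) : Submodule ℝ E where
  carrier := {x | Summable fun n => S.ev n ^ (2 * p) * (inner ℝ (S.e n) x) ^ 2}
  zero_mem' := by simp [summable_zero]
  add_mem' := by
    intro x y hx hy
    refine Summable.of_nonneg_of_le (fun n => ?_) (fun n => ?_) ((hx.add hy).mul_left 2)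
    · have := pow_nonneg (zero_le_one.trans (S.one_lt_ev n).le) (2 * p)
      positivity
    · have := pow_nonneg (zero_le_one.trans (S.one_lt_ev n).le) (2 * p)
      rw [inner_add_right]
      nlinarith [mul_nonneg this (sq_nonneg (inner ℝ (S.e n) x - inner ℝ (S.e n) y))]
  smul_mem' := by
    intro c x hx
    refine (hx.mul_left (c ^ 2)).congr (fun n => ?_)
    rw [inner_smul_right]
    ring

/-- The space `H = ⋂ₚ H_p`, as a type of its own: it carries its nuclear topology,
not the topology induced by `H₀`. -/
def Nucl : Type _ := (⨅ p, S.Hp p : Submodule ℝ E)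

instance : AddCommGroup S.Nucl := inferInstanceAs (AddCommGroup (⨅ p, S.Hp p : Submodule ℝ E))
instance : Module ℝ S.Nucl := inferInstanceAs (Module ℝ (⨅ p, S.Hp p : Submodule ℝ E))

/-- The inclusion `H → H₀`. -/
def incl : S.Nucl →ₗ[ℝ] E := (⨅ p, S.Hp p : Submodule ℝ E).subtype

lemma memlp_weight (p : ℕ) (x : S.Nucl) :
    Memℓp (fun n => S.ev n ^ p * inner ℝ (S.e n) (S.incl x)) 2 := by
  have h : S.incl x ∈ S.Hp p := (Submodule.mem_iInf _).1 x.2 p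
  refine memℓp_gen ((show Summable _ from h).congr fun n => ?_)
  rw [show (2 : ℝ≥0∞).toReal = ((2 : ℕ) : ℝ) by simp, Real.rpow_natCast, Real.norm_eq_abs,
    sq_abs]
  ring

/-- The operator `A^p : H → H₀`, `A^p x = ∑ₙ λₙ^p ⟨x, eₙ⟩ eₙ`; so `|x|_p = ‖A^p x‖`. -/
def powA [CompleteSpace E] (p : ℕ) : S.Nucl →ₗ[ℝ] E where
  toFun x := S.e.repr.symm ⟨_, S.memlp_weight p x⟩
  map_add' x y := by
    rw [← map_add]
    congr 1
    ext n
    simp only [map_add, inner_add_right, mul_add]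
    rfl
  map_smul' c x := by
    rw [RingHom.id_apply, ← map_smul]
    congr 1
    ext n
    simp [inner_smul_right, mul_left_comm]

variable [CompleteSpace E]

/-- The topology of `H` generated by the norms `|x|_p = ‖A^p x‖`, `p = 0, 1, 2, …`. -/
instance : TopologicalSpace S.Nucl := ⨅ p, TopologicalSpace.induced (S.powA p) inferInstance

instance : IsTopologicalAddGroup S.Nucl :=
  topologicalAddGroup_iInf fun p => topologicalAddGroup_induced (S.powA p)

instance : ContinuousSMul ℝ S.Nucl :=
  continuousSMul_iInf fun p => continuousSMul_induced (S.powA p)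

lemma powA_zero (x : S.Nucl) : S.powA 0 x = S.incl x := by
  refine (LinearIsometryEquiv.symm_apply_eq _).2 ?_
  ext n
  simp [HilbertBasis.repr_apply_apply]

lemma continuous_incl : Continuous S.incl := by
  have h : Continuous (S.powA 0) := continuous_iInf_dom (i := 0) continuous_induced_dom
  exact h.congr S.powA_zero

/-- The dual `H'` of `H`, with its strong topology (uniform convergence on bounded sets). -/
abbrev Dual : Type _ := StrongDual ℝ S.Nucl

/-- The `σ`-algebra of `H'` generated by the maps `x ↦ ⟨x, y⟩`, `y ∈ H`. -/
instance : MeasurableSpace S.Dual :=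
  ⨆ y : S.Nucl, MeasurableSpace.comap (fun x : S.Dual => x y) (borel ℝ)

/-- The inclusion `H₀ ≃ H₀' ⊆ H'`: the vector `a` acts on `H` as `y ↦ ⟨a, y⟩`. -/
def toDual (a : E) : S.Dual :=
  (innerSL ℝ a).comp ⟨S.incl, S.continuous_incl⟩

/-! ### Gaussian measures -/

/-- `μ` is the white noise measure, the standard Gaussian measure on `H'`: its characteristic
function is `exp (-|y|₀² / 2)`. -/
def IsWhiteNoiseMeasure (μ : Measure S.Dual) : Prop :=
  IsProbabilityMeasure μ ∧ ∀ y : S.Nucl,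
    ∫ x, Complex.exp (Complex.I * (x y : ℝ)) ∂μ = Complex.exp (-(‖S.incl y‖ ^ 2 : ℝ) / 2)

/-- The white noise measure `μ`. -/
def gaussian : Measure S.Dual := Classical.epsilon S.IsWhiteNoiseMeasure

/-- `ν` is the Gaussian measure for the affine subspace `a + V`: its characteristic function is
`exp (i⟨a, y⟩ - ⟨y_V, y_V⟩ / 2)`, where `y_V` is the orthogonal projection of `y` onto `V` (onto its
closure, if `V` is not closed). -/
def IsAffineGaussian (a : E) (V : Submodule ℝ E) (ν : Measure S.Dual) : Prop :=
  IsProbabilityMeasure ν ∧ ∀ y : S.Nucl,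
    ∫ x, Complex.exp (Complex.I * (x y : ℝ)) ∂ν =
      Complex.exp (Complex.I * (inner ℝ a (S.incl y) : ℝ) -
        (‖V.topologicalClosure.starProjection (S.incl y)‖ ^ 2 : ℝ) / 2)

/-- The Gaussian measure `μ_{a+V}` for the affine subspace `a + V`. -/
def affineGaussian (a : E) (V : Submodule ℝ E) : Measure S.Dual :=
  Classical.epsilon (S.IsAffineGaussian a V)

/-! ### Fock space, the Wiener–Itô isomorphism and Hida test functions -/

/-- Coordinates of an element `(f₀, f₁, f₂, …)` of the complexified (completed) tensor algebra:
`f ⟨n, i⟩` is the coefficient of `e_{i 0} ⊗ ⋯ ⊗ e_{i (n-1)}` in the tensor `fₙ` of degree `n`. -/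
abbrev Tensors : Type := (Σ n : ℕ, (Fin n → ℕ)) → ℂ

/-- The squared norm `∑ₙ n! |fₙ|²` on the tensor algebra of `H_p`, where
`e_{i 0} ⊗ ⋯ ⊗ e_{i (n-1)}` has squared norm `∏ⱼ λ_{i j}^{2p}` in the `n`-th tensor power of
`H_p`. -/
def fockNormSq (p : ℕ) (f : Tensors) : ℝ≥0∞ :=
  ∑' k : (Σ n : ℕ, (Fin n → ℕ)),
    (k.1.factorial : ℝ≥0∞) * ENNReal.ofReal (∏ j, S.ev (k.2 j) ^ (2 * p)) * ‖f k‖ₑ ^ 2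

/-- The complexified symmetric Fock space over `H_p`: the sequences of symmetric tensors of finite
Fock norm. -/
def fock (p : ℕ) : Set Tensors :=
  {f | (∀ (n : ℕ) (σ : Equiv.Perm (Fin n)) (i : Fin n → ℕ), f ⟨n, i ∘ σ⟩ = f ⟨n, i⟩) ∧
    S.fockNormSq p f < ∞}

/-- `Exp x = ∑ₙ x^{⊗ n} / n!`. -/
def expTensor (x : S.Nucl) : Tensors := fun k =>
  (((k.1.factorial : ℝ)⁻¹ * ∏ j, inner ℝ (S.e (k.2 j)) (S.incl x) : ℝ) : ℂ)

/-- The renormalized exponential `exp (⟨·, x⟩ - |x|₀² / 2)` on `H'`. -/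
def expFun (x : S.Nucl) : S.Dual → ℂ := fun ω =>
  Complex.exp ((ω x - ‖S.incl x‖ ^ 2 / 2 : ℝ) : ℂ)

/-- `F = I f` for the Wiener–Itô isomorphism `I` of the symmetric Fock space over `H₀` onto
`L²(H', μ)`. As `I` is the continuous linear extension of `Exp x ↦ exp (⟨·, x⟩ - |x|₀² / 2)`,
`x ∈ H`, its graph is the closure of the linear span of the pairs of these elements. -/
def IsWienerIto (f : Tensors) (F : S.Dual → ℂ) : Prop :=
  f ∈ S.fock 0 ∧ MemLp F 2 S.gaussian ∧
    ∀ ε : ℝ≥0∞, 0 < ε → ∃ c : S.Nucl →₀ ℂ,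
      S.fockNormSq 0 (f - Finsupp.linearCombination ℂ S.expTensor c) < ε ∧
      eLpNorm (F - Finsupp.linearCombination ℂ S.expFun c) 2 S.gaussian < ε

/-- The space `[H]_p ⊆ L²(H', μ)`, the image under `I` of the symmetric Fock space over `H_p`. -/
def secondQuant (p : ℕ) : Set (S.Dual → ℂ) := {F | ∃ f ∈ S.fock p, S.IsWienerIto f F}

/-- The space `[H] = ⋂ₚ [H]_p` of Hida test functions, each represented by its continuous
version. -/
def testFunctions : Set (S.Dual → ℂ) := {φ | Continuous φ ∧ ∀ p, φ ∈ S.secondQuant p}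

end WhiteNoise

end

/-! Through A², `emb` identifies H₋₂ with H₀, and every measure in the theorem is carried by H₋₂.
Let P be the projection onto the closure of V. Since ∑ λₙ⁻² < ∞, the operator P A⁻² is absolutely
summable along the basis, so H₀ carries a centered Gaussian measure γV with characteristic function
exp(-‖P A⁻² t‖²/2) (`exists_measure_charFun_eq`). In these coordinates a ∈ H₀ is the point A⁻² a,
and μ_{a+V} is the image of γV under u ↦ emb (u + A⁻² a). Hence the equality of the integrals is a
change of variables, and the work lies in integrability.

A test function is the continuous representative of a μ-class, while μ_{a+V} may be singular to μ,
so φ has to be controlled at every point of H₋₂. Let γ be the Gaussian measure on H₀ that induces μ,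
and let f(z) = ∑ ⟨fₙ, z^{⊗n}⟩ on the complexification of H₋₂. The function u ↦ ∫ f(u + iv) dγ(v),
`chaosVersion`, is continuous and has the same S-transform as I f: the Cameron–Martin formula turns
the exponential into a shift, and by rotation invariance the moments of u + iv of positive order
vanish. Laplace transforms against γ determine square integrable functions, and γ has full support,
so φ equals `chaosVersion` everywhere on H₋₂ (`comp_emb_eq_chaosVersion`).

This gives |φ| ≤ M exp(2 w_p ‖u‖²) on H₋₂, where w_p is `hsWeight p`. As 1 < λ₀, w_p tends to 0. As
φ lies in every [H]_p, w_p can be taken below the exponents that Fernique's theorem allows for γ and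
γV. -/

noncomputable section

open ProbabilityTheory Filter Topology

/-! ### Isonormal Gaussian process over a Hilbert space. -/

section Isonormal

/-- The law of a sequence of independent standard Gaussian random variables. -/
abbrev stdNoise : Measure (ℕ → ℝ) := Measure.infinitePi fun _ => gaussianReal 0 1

lemma measurePreserving_eval_stdNoise (n : ℕ) :
    MeasurePreserving (fun x : ℕ → ℝ => x n) stdNoise (gaussianReal 0 1) :=
  measurePreserving_eval_infinitePi (fun _ : ℕ => gaussianReal 0 1) n

lemma memLp_eval_stdNoise (n : ℕ) : MemLp (fun x : ℕ → ℝ => x n) 2 stdNoise :=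
  (memLp_id_gaussianReal (μ := 0) (v := 1) 2).comp_measurePreserving
    (measurePreserving_eval_stdNoise n)

lemma iIndepFun_stdNoise : iIndepFun (fun (n : ℕ) (x : ℕ → ℝ) => x n) stdNoise :=
  iIndepFun_infinitePi (P := fun _ : ℕ => gaussianReal 0 1) (X := fun _ x => x)
    fun _ => measurable_id

lemma integral_comp_eval_stdNoise {F : Type*} [NormedAddCommGroup F] [NormedSpace ℝ F] (n : ℕ)
    {f : ℝ → F} (hf : Continuous f) :
    ∫ x, f (x n) ∂stdNoise = ∫ t, f t ∂gaussianReal 0 1 := by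
  have h := measurePreserving_eval_stdNoise n
  rw [← h.map_eq, integral_map h.measurable.aemeasurable hf.aestronglyMeasurable]

lemma orthonormal_eval_stdNoise :
    Orthonormal ℝ fun n => (memLp_eval_stdNoise n).toLp := by
  classical
  have h0 (n : ℕ) : ∫ x, x n ∂stdNoise = 0 := by
    rw [integral_comp_eval_stdNoise n (f := fun t => t) continuous_id, integral_id_gaussianReal]
  rw [orthonormal_iff_ite]
  intro m n
  rw [L2.inner_def]
  have h1 : ∫ x, inner ℝ ((memLp_eval_stdNoise m).toLp _ x) ((memLp_eval_stdNoise n).toLp _ x)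
      ∂stdNoise = ∫ x, x m * x n ∂stdNoise := by
    refine integral_congr_ae ?_
    filter_upwards [(memLp_eval_stdNoise m).coeFn_toLp, (memLp_eval_stdNoise n).coeFn_toLp]
      with x hm hn
    rw [hm, hn]
    simp [mul_comm]
  rw [h1]
  split_ifs with hmn
  · subst hmn
    rw [integral_comp_eval_stdNoise m (f := fun t => t * t) (by fun_prop)]
    have := variance_of_integral_eq_zero (μ := gaussianReal 0 1) (X := id)
      aemeasurable_id integral_id_gaussianReal
    rw [variance_id_gaussianReal] at this
    simpa [sq] using this.symm
  · rw [(iIndepFun_stdNoise.indepFun hmn).integral_fun_mul_eq_mul_integral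
      (memLp_eval_stdNoise m).1 (memLp_eval_stdNoise n).1, h0, zero_mul]

/-- The isonormal Gaussian process over a Hilbert space with an orthonormal basis. -/
def isonormal {E : Type*} [NormedAddCommGroup E] [InnerProductSpace ℝ E]
    (e : HilbertBasis ℕ ℝ E) : E →ₗᵢ[ℝ] Lp ℝ 2 stdNoise :=
  orthonormal_eval_stdNoise.orthogonalFamily.linearIsometry.comp e.repr.toLinearIsometry

/-- The map is 1-Lipschitz, because |e^{ix} - e^{iy}| ≤ |x - y| and the L¹ norm is at most the L²
norm on a probability space. This extends the Gaussian characteristic function from finite sums to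
the whole space. -/
lemma continuous_integral_exp_lp {Ω : Type*} [MeasurableSpace Ω] (P : Measure Ω)
    [IsProbabilityMeasure P] :
    Continuous fun X : Lp ℝ 2 P => ∫ ω, Complex.exp (Complex.I * (X ω : ℝ)) ∂P := by
  refine LipschitzWith.continuous (K := 1) (LipschitzWith.of_dist_le_mul fun X Y => ?_)
  have hi (Z : Lp ℝ 2 P) : Integrable (fun ω => Complex.exp (Complex.I * (Z ω : ℝ))) P := by
    refine Integrable.of_bound (C := 1) ?_ (ae_of_all _ fun ω => ?_)
    · have := Lp.aestronglyMeasurable Z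
      exact (by fun_prop : Continuous fun t : ℝ => Complex.exp (Complex.I * t)).comp_aestronglyMeasurable
        this
    · rw [mul_comm, Complex.norm_exp_ofReal_mul_I]
  rw [dist_eq_norm, ← integral_sub (hi X) (hi Y), NNReal.coe_one, one_mul, dist_eq_norm]
  have h1 : Integrable (X - Y : Lp ℝ 2 P) P := (Lp.memLp (X - Y)).integrable (by norm_num)
  calc _ ≤ ∫ ω, ‖(X - Y : Lp ℝ 2 P) ω‖ ∂P := by
        refine norm_integral_le_of_norm_le h1.norm ?_
        filter_upwards [Lp.coeFn_sub X Y] with ω h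
        rw [h]
        have : Complex.exp (Complex.I * (X ω : ℝ)) - Complex.exp (Complex.I * (Y ω : ℝ))
            = Complex.exp (Complex.I * (Y ω : ℝ)) *
              (Complex.exp (Complex.I * ((X ω - Y ω : ℝ) : ℂ)) - 1) := by
          rw [mul_sub, ← Complex.exp_add]
          congr 2
          · push_cast; ring
          · ring
        rw [this, norm_mul, mul_comm Complex.I (Y ω : ℂ), Complex.norm_exp_ofReal_mul_I, one_mul]
        exact Real.norm_exp_I_mul_ofReal_sub_one_le
    _ = (eLpNorm (X - Y : Lp ℝ 2 P) 1 P).toReal := by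
        rw [eLpNorm_one_eq_lintegral_enorm, integral_norm_eq_lintegral_enorm h1.1]
    _ ≤ _ := by
        rw [Lp.norm_def]
        exact ENNReal.toReal_mono (Lp.eLpNorm_ne_top _)
          (eLpNorm_le_eLpNorm_of_exponent_le (by norm_num) h1.1)

lemma isonormal_apply_basis {E : Type*} [NormedAddCommGroup E] [InnerProductSpace ℝ E]
    (e : HilbertBasis ℕ ℝ E) (n : ℕ) : isonormal e (e n) = (memLp_eval_stdNoise n).toLp := by
  classical
  change orthonormal_eval_stdNoise.orthogonalFamily.linearIsometry (e.repr (e n)) = _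
  rw [e.repr_self, OrthogonalFamily.linearIsometry_apply_single]
  simp

lemma integral_exp_sum_stdNoise (s : Finset ℕ) (c : ℕ → ℝ) :
    ∫ ω, Complex.exp (Complex.I * (∑ i ∈ s, c i * ω i : ℝ)) ∂stdNoise =
      Complex.exp (-(∑ i ∈ s, c i ^ 2 : ℝ) / 2) := by
  have h1 : iIndepFun (fun (n : s) (x : ℕ → ℝ) => x n) stdNoise :=
    iIndepFun_stdNoise.precomp Subtype.val_injective
  have h2 := h1.integral_fun_prod_comp (f := fun (i : s) (t : ℝ) =>
      Complex.exp (c i * t * Complex.I))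
    (fun i => (measurePreserving_eval_stdNoise i).measurable.aemeasurable)
    (fun i => Continuous.aestronglyMeasurable (by fun_prop))
  have h3 (i : s) : ∫ ω : ℕ → ℝ, Complex.exp (c i * ω i * Complex.I) ∂stdNoise =
      Complex.exp (-(c i ^ 2 : ℝ) / 2) := by
    rw [integral_comp_eval_stdNoise i.1 (f := fun t => Complex.exp (c i * t * Complex.I))
      (by fun_prop), ← charFun_apply_real, charFun_gaussianReal]
    congr 1
    simp
    ring
  calc _ = ∫ ω : ℕ → ℝ, ∏ i : s, Complex.exp (c i * ω i * Complex.I) ∂stdNoise := by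
        congr with ω
        rw [← Complex.exp_sum, Finset.sum_coe_sort s fun i => (c i : ℂ) * ω i * Complex.I]
        push_cast
        rw [Finset.mul_sum]
        exact congrArg _ (Finset.sum_congr rfl fun i _ => by ring)
    _ = ∏ i : s, Complex.exp (-(c i ^ 2 : ℝ) / 2) := by
        rw [h2]
        exact Finset.prod_congr rfl fun i _ => h3 i
    _ = _ := by
        rw [← Complex.exp_sum, Finset.sum_coe_sort s fun i => -((c i ^ 2 : ℝ) : ℂ) / 2]
        push_cast
        rw [← Finset.sum_neg_distrib, Finset.sum_div]

lemma integral_exp_isonormal {E : Type*} [NormedAddCommGroup E] [InnerProductSpace ℝ E]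
    (e : HilbertBasis ℕ ℝ E) (h : E) :
    ∫ ω, Complex.exp (Complex.I * (isonormal e h ω : ℝ)) ∂stdNoise =
      Complex.exp (-(‖h‖ ^ 2 : ℝ) / 2) := by
  have hs : HasSum (fun i => inner ℝ (e i) h • e i) h := by
    simpa only [e.repr_apply_apply] using e.hasSum_repr h
  have h1 := ((continuous_integral_exp_lp stdNoise).comp
    (isonormal e).continuous).continuousAt.tendsto.comp hs
  have h2 : Tendsto (fun s : Finset ℕ => Complex.exp (-(‖∑ i ∈ s, inner ℝ (e i) h • e i‖ ^ 2 : ℝ) / 2))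
      atTop (𝓝 (Complex.exp (-(‖h‖ ^ 2 : ℝ) / 2))) :=
    ((by fun_prop : Continuous fun y : E =>
      Complex.exp (-(‖y‖ ^ 2 : ℝ) / 2)).continuousAt.tendsto).comp hs
  refine tendsto_nhds_unique h1 (h2.congr fun s => ?_)
  have h3 : (isonormal e (∑ i ∈ s, inner ℝ (e i) h • e i) : Lp ℝ 2 stdNoise) =ᵐ[stdNoise]
      fun ω => ∑ i ∈ s, inner ℝ (e i) h * ω i := by
    rw [map_sum]
    refine (Lp.coeFn_finsetSum s _).trans ?_
    have : ∀ᵐ ω ∂stdNoise, ∀ i : ℕ, (isonormal e (inner ℝ (e i) h • e i) : Lp ℝ 2 stdNoise) ω =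
        inner ℝ (e i) h * ω i := by
      rw [ae_all_iff]
      intro i
      rw [map_smul, isonormal_apply_basis]
      filter_upwards [Lp.coeFn_smul (inner ℝ (e i) h) ((memLp_eval_stdNoise i).toLp),
        (memLp_eval_stdNoise i).coeFn_toLp] with ω h4 h5
      rw [h4, Pi.smul_apply, h5, smul_eq_mul]
    filter_upwards [this] with ω hω
    rw [Finset.sum_apply]
    exact Finset.sum_congr rfl fun i _ => hω i
  have h4 : ‖∑ i ∈ s, inner ℝ (e i) h • e i‖ ^ 2 = ∑ i ∈ s, inner ℝ (e i) h ^ 2 := by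
    rw [← real_inner_self_eq_norm_sq, e.orthonormal.inner_sum]
    simp [sq]
  rw [h4, ← integral_exp_sum_stdNoise]
  refine integral_congr_ae ?_
  filter_upwards [h3] with ω hω
  exact congrArg (fun t : ℝ => Complex.exp (Complex.I * t)) hω.symm

end Isonormal

/-! ### Existence of Gaussian measures on a Hilbert space. -/

section GaussianOnHilbert

variable {E : Type*} [NormedAddCommGroup E] [InnerProductSpace ℝ E] [CompleteSpace E]

/-- The centered Gaussian measure on a Hilbert space whose covariance operator is `T* T`, where
`T` maps the vectors of some orthonormal basis to a summable sequence. -/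
theorem exists_measure_charFun_eq [MeasurableSpace E] [BorelSpace E] (e : HilbertBasis ℕ ℝ E)
    (T : E →L[ℝ] E) (hT : Summable fun n => ‖T (e n)‖) :
    ∃ γ : Measure E, IsProbabilityMeasure γ ∧
      ∀ t, charFun γ t = Complex.exp (-(‖T t‖ ^ 2 : ℝ) / 2) := by
  set W := isonormal e
  -- The measure is the law of the random vector U = ∑ W(T eₙ) eₙ, a series that converges
  -- absolutely in L²(E).
  set u : ℕ → Lp E 2 stdNoise := fun n =>
    (ContinuousLinearMap.toSpanSingleton ℝ (e n)).compLpL 2 stdNoise (W (T (e n)))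
  have hu : Summable u := by
    refine Summable.of_norm_bounded hT fun n => ?_
    refine (ContinuousLinearMap.norm_compLp_le _ _).trans ?_
    rw [ContinuousLinearMap.norm_toSpanSingleton, e.orthonormal.1 n, one_mul,
      LinearIsometry.norm_map]
  set U := ∑' n, u n
  have hUm : AEMeasurable U stdNoise := (Lp.aestronglyMeasurable U).aemeasurable
  refine ⟨stdNoise.map U, Measure.isProbabilityMeasure_map hUm, fun t => ?_⟩
  -- Pairing with t termwise gives ∑ ⟨eₙ, t⟩ W(T eₙ), which is W(T t) by linearity and continuity.
  have h1 : (innerSL ℝ t).compLpL 2 stdNoise U = W (T t) := by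
    refine HasSum.unique (hu.hasSum.mapL ((innerSL ℝ t).compLpL 2 stdNoise)) ?_
    have h2 : HasSum (fun n => W (T (inner ℝ (e n) t • e n))) (W (T t)) := by
      have h := (e.hasSum_repr t).mapL (W.toContinuousLinearMap.comp T)
      simp only [e.repr_apply_apply] at h
      exact h
    convert h2 using 2 with n
    rw [map_smul, map_smul]
    refine Lp.ext ?_
    filter_upwards [ContinuousLinearMap.coeFn_compLpL (innerSL ℝ t) (u n),
      ContinuousLinearMap.coeFn_compLpL (ContinuousLinearMap.toSpanSingleton ℝ (e n))
        (W (T (e n))), Lp.coeFn_smul (inner ℝ (e n) t) (W (T (e n)))] with ω h3 h4 h5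
    rw [h3]
    erw [h4, h5]
    simp [real_inner_comm, mul_comm]
  rw [charFun_apply, integral_map hUm (Continuous.aestronglyMeasurable (by fun_prop)),
    ← integral_exp_isonormal e, ← h1]
  refine integral_congr_ae ?_
  filter_upwards [ContinuousLinearMap.coeFn_compLpL (innerSL ℝ t) U] with ω h3
  rw [h3]
  simp [real_inner_comm, mul_comm]

end GaussianOnHilbert

/-! ### Laplace transforms, the Cameron–Martin formula and full support. -/

section GaussianCalculus

variable {E : Type*} [NormedAddCommGroup E] [InnerProductSpace ℝ E]
  [MeasurableSpace E]

/-- The characteristic function is the complex moment generating function at the point i, so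
analytic continuation can reach it from real exponentials. -/
lemma charFun_eq_complexMGF_inner (μ : Measure E) (t : E) :
    charFun μ t = complexMGF (fun u => inner ℝ u t) μ ((0 : ℝ) + (1 : ℝ) * Complex.I) := by
  simp [charFun_apply, complexMGF, mul_comm]

variable [BorelSpace E]

/-- Finite measures on a Hilbert space are determined by their Laplace transforms on a dense
subspace, as soon as these are finite. -/
theorem Measure.ext_of_integral_exp_inner [CompleteSpace E] [SecondCountableTopology E] {μ ν : Measure E}
    [IsFiniteMeasure μ] [IsFiniteMeasure ν] (D : Submodule ℝ E) (hD : Dense (D : Set E))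
    (hμ : ∀ t ∈ D, Integrable (fun u => Real.exp (inner ℝ u t)) μ)
    (h : ∀ t ∈ D, ∫ u, Real.exp (inner ℝ u t) ∂μ = ∫ u, Real.exp (inner ℝ u t) ∂ν) : μ = ν := by
  -- At t = 0 the hypothesis compares the total masses.
  have h0 : μ = 0 ↔ ν = 0 := by
    have := h 0 D.zero_mem
    simp only [inner_zero_right, Real.exp_zero, integral_const, smul_eq_mul, mul_one] at this
    rw [Measure.measure_univ_eq_zero.symm.trans (measureReal_eq_zero_iff (measure_ne_top _ _)).symm, this,
      measureReal_eq_zero_iff (measure_ne_top _ _), Measure.measure_univ_eq_zero]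
  refine Measure.ext_of_charFun (Continuous.ext_on hD continuous_charFun continuous_charFun
    fun t ht => ?_)
  -- As D is closed under scaling, the two generating functions agree on the whole real line, and
  -- then also at i.
  have h1 : mgf (fun u => inner ℝ u t) μ = mgf (fun u => inner ℝ u t) ν := by
    ext s
    have := h (s • t) (D.smul_mem s ht)
    simpa only [mgf, inner_smul_right] using this
  have h2 : integrableExpSet (fun u => inner ℝ u t) μ = Set.univ := by
    refine Set.eq_univ_of_forall fun s => ?_
    have := hμ (s • t) (D.smul_mem s ht)
    simpa only [integrableExpSet, inner_smul_right, Set.mem_ofPred_eq] using this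
  rw [charFun_eq_complexMGF_inner, charFun_eq_complexMGF_inner]
  exact eqOn_complexMGF_of_mgf' h1 h0 (by simp [h2])

variable {γ : Measure E} [IsProbabilityMeasure γ] {T : E →L[ℝ] E}

lemma map_inner_eq_gaussianReal
    (hγ : ∀ t, charFun γ t = Complex.exp (-(‖T t‖ ^ 2 : ℝ) / 2))
    (t : E) :
    γ.map (fun u => inner ℝ u t) = gaussianReal 0 (‖T t‖₊ ^ 2) := by
  have hm : Measurable fun u : E => inner ℝ u t := (by fun_prop : Continuous _).measurable
  have := Measure.isProbabilityMeasure_map (μ := γ) hm.aemeasurable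
  refine Measure.ext_of_charFun (funext fun s => ?_)
  rw [charFun_apply, integral_map hm.aemeasurable
    (Continuous.aestronglyMeasurable (by fun_prop)), charFun_gaussianReal]
  have := hγ (s • t)
  rw [charFun_apply] at this
  simp only [inner_smul_right, map_smul, norm_smul] at this
  simp only [RCLike.inner_apply, conj_trivial]
  rw [this]
  congr 1
  rw [mul_pow, Real.norm_eq_abs, sq_abs]
  push_cast
  simp
  ring

lemma integrable_exp_inner
    (hγ : ∀ t, charFun γ t = Complex.exp (-(‖T t‖ ^ 2 : ℝ) / 2))
    (t : E) : Integrable (fun u => Real.exp (inner ℝ u t)) γ := by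
  have hm : Measurable fun u : E => inner ℝ u t := (by fun_prop : Continuous _).measurable
  have h := integrable_exp_mul_gaussianReal (μ := 0) (v := ‖T t‖₊ ^ 2) 1
  rw [← map_inner_eq_gaussianReal hγ t] at h
  simpa [Function.comp_def] using (integrable_map_measure h.1 hm.aemeasurable).1 h

lemma integral_exp_inner
    (hγ : ∀ t, charFun γ t = Complex.exp (-(‖T t‖ ^ 2 : ℝ) / 2))
    (t : E) :
    ∫ u, Real.exp (inner ℝ u t) ∂γ = Real.exp (‖T t‖ ^ 2 / 2) := by
  have := mgf_gaussianReal (map_inner_eq_gaussianReal hγ t) 1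
  simpa [mgf] using this

lemma memLp_exp_inner
    (hγ : ∀ t, charFun γ t = Complex.exp (-(‖T t‖ ^ 2 : ℝ) / 2))
    (t : E) : MemLp (fun u => Real.exp (inner ℝ u t)) 2 γ := by
  refine (memLp_two_iff_integrable_sq (Continuous.aestronglyMeasurable (by fun_prop))).2 ?_
  refine (integrable_exp_inner hγ ((2 : ℝ) • t)).congr (ae_of_all _ fun u => ?_)
  simp only [inner_smul_right]
  rw [← Real.exp_nat_mul]
  norm_num

variable [CompleteSpace E]

lemma isGaussian_of_charFun_eq
    (hγ : ∀ t, charFun γ t = Complex.exp (-(‖T t‖ ^ 2 : ℝ) / 2))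
    : IsGaussian γ := by
  refine isGaussian_of_map_eq_gaussianReal fun L => ⟨0, _,
    Eq.trans ?_ (map_inner_eq_gaussianReal hγ ((InnerProductSpace.toDual ℝ E).symm L))⟩
  congr with u
  rw [real_inner_comm, InnerProductSpace.toDual_symm_apply]

lemma map_rotation_eq_of_charFun_eq [SecondCountableTopology E]
    (hγ : ∀ t, charFun γ t = Complex.exp (-(‖T t‖ ^ 2 : ℝ) / 2))
    (θ : ℝ) :
    (γ.prod γ).map (ContinuousLinearMap.rotation θ) = γ.prod γ := by
  have := isGaussian_of_charFun_eq hγ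
  refine IsGaussian.map_rotation_eq_self_of_forall_strongDual_eq_zero (fun L => ?_) θ
  obtain ⟨t, rfl⟩ := (InnerProductSpace.toDual ℝ E).surjective L
  have h := map_inner_eq_gaussianReal hγ t
  have hm : Measurable fun u : E => inner ℝ u t := (by fun_prop : Continuous _).measurable
  have h2 := integral_id_gaussianReal (μ := 0) (v := ‖T t‖₊ ^ 2)
  rw [← h, integral_map hm.aemeasurable (by fun_prop)] at h2
  simpa [real_inner_comm] using h2

/-- The Cameron–Martin formula. -/
theorem map_add_eq_withDensity [SecondCountableTopology E]
    (hγ : ∀ t, charFun γ t = Complex.exp (-(‖T t‖ ^ 2 : ℝ) / 2))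
    (t : E) :
    γ.map (fun u => u + T.adjoint (T t)) =
      γ.withDensity fun u => ENNReal.ofReal (Real.exp (inner ℝ u t - ‖T t‖ ^ 2 / 2)) := by
  have hint : Integrable (fun u => Real.exp (inner ℝ u t - ‖T t‖ ^ 2 / 2)) γ := by
    simp_rw [Real.exp_sub]
    exact (integrable_exp_inner hγ t).div_const _
  have hm : AEMeasurable (fun u => u + T.adjoint (T t)) γ := by fun_prop
  have := Measure.isProbabilityMeasure_map hm
  have := isFiniteMeasure_withDensity_ofReal hint.2
  refine Measure.ext_of_integral_exp_inner ⊤ (by simp) (fun s _ => ?_) fun s _ => ?_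
  · rw [integrable_map_measure (Continuous.aestronglyMeasurable (by fun_prop)) hm]
    simp only [Function.comp_def, inner_add_left, Real.exp_add]
    exact (integrable_exp_inner hγ s).mul_const _
  · rw [integral_map hm (Continuous.aestronglyMeasurable (by fun_prop)),
      integral_withDensity_eq_integral_toReal_smul (by fun_prop) (by simp)]
    simp only [inner_add_left,
      ENNReal.toReal_ofReal (Real.exp_nonneg _), smul_eq_mul, ← Real.exp_add,
      ContinuousLinearMap.adjoint_inner_left]
    have h1 (u : E) : inner ℝ u t - ‖T t‖ ^ 2 / 2 + inner ℝ u s =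
        inner ℝ u (t + s) + -(‖T t‖ ^ 2 / 2) := by
      rw [inner_add_right]; ring
    simp only [h1, Real.exp_add, integral_mul_const, integral_exp_inner hγ]
    rw [← Real.exp_add, ← Real.exp_add, map_add, norm_add_sq_real]
    congr 1
    ring

/-- The support of a Gaussian measure whose Cameron–Martin space is dense is the full space. -/
theorem eq_empty_of_isOpen_of_measure_eq_zero [SecondCountableTopology E]
    (hγ : ∀ t, charFun γ t = Complex.exp (-(‖T t‖ ^ 2 : ℝ) / 2))
    (hT : DenseRange fun t => T.adjoint (T t)) {U : Set E} (hU : IsOpen U) (h0 : γ U = 0) :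
    U = ∅ := by
  by_contra hne
  obtain ⟨u₀, hu₀⟩ := Set.nonempty_iff_ne_empty.2 hne
  refine IsProbabilityMeasure.ne_zero γ (Measure.measure_univ_eq_zero.1
    (measure_null_of_locally_null _ fun u _ => ?_))
  have hU' : IsOpen ((fun h => u + h) ⁻¹' U) := hU.preimage (by fun_prop)
  -- A Cameron–Martin shift moves u into U. The shifted measure is absolutely continuous, so the
  -- preimage of U under the shift is a null neighbourhood of u; were U nonempty, the whole space
  -- would be null.
  obtain ⟨t, ht⟩ := hT.exists_mem_open hU' ⟨u₀ - u, by simpa using hu₀⟩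
  refine ⟨(fun u => u + T.adjoint (T t)) ⁻¹' U, mem_nhdsWithin_of_mem_nhds
    ((hU.preimage (by fun_prop)).mem_nhds ht), ?_⟩
  rw [← Measure.map_apply (by fun_prop) hU.measurableSet, map_add_eq_withDensity hγ]
  exact withDensity_absolutelyContinuous _ _ h0

end GaussianCalculus

/-! ### The embedding of H₋₂ into H' and measures on H'. -/

namespace WhiteNoise

variable {E : Type*} [NormedAddCommGroup E] [InnerProductSpace ℝ E] (S : WhiteNoise E)

lemma ev_pos (n : ℕ) : 0 < S.ev n := zero_lt_one.trans (S.one_lt_ev n)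

lemma ext_coord {u v : E} (h : ∀ n, inner ℝ (S.e n) u = inner ℝ (S.e n) v) : u = v := by
  refine S.e.repr.injective (lp.ext (funext fun n => ?_))
  simpa only [S.e.repr_apply_apply] using h n

lemma secondCountableTopology (S : WhiteNoise E) : SecondCountableTopology E := by
  have h : TopologicalSpace.SeparableSpace E := by
    rw [← TopologicalSpace.isSeparable_univ_iff]
    have h1 := (TopologicalSpace.IsSeparable.span (R := ℝ)
      (Set.countable_range S.e).isSeparable).closure
    have h2 : closure (Submodule.span ℝ (Set.range S.e) : Set E) = Set.univ := by
      rw [← Submodule.topologicalClosure_coe, S.e.dense_span, Submodule.top_coe]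
    rwa [h2] at h1
  exact UniformSpace.secondCountable_of_separable E

lemma inner_basis (m n : ℕ) : inner ℝ (S.e m) (S.e n) = if m = n then (1 : ℝ) else 0 :=
  (orthonormal_iff_ite.1 S.e.orthonormal) m n

/-- The basis vector `e_n` as an element of the nuclear space. -/
def basis (n : ℕ) : S.Nucl :=
  (⟨S.e n, (Submodule.mem_iInf _).2 fun p => by
    refine summable_of_ne_finset_zero (s := {n}) fun m hm => ?_
    rw [Finset.mem_singleton] at hm
    simp [S.inner_basis, hm]⟩ : (⨅ p, S.Hp p : Submodule ℝ E))

@[simp] lemma incl_basis (n : ℕ) : S.incl (S.basis n) = S.e n := rfl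

variable [CompleteSpace E]

lemma inner_powA (p n : ℕ) (y : S.Nucl) :
    inner ℝ (S.e n) (S.powA p y) = S.ev n ^ p * inner ℝ (S.e n) (S.incl y) := by
  rw [← S.e.repr_apply_apply]
  simp [powA]

lemma powA_basis (p n : ℕ) : S.powA p (S.basis n) = S.ev n ^ p • S.e n := by
  refine S.ext_coord fun m => ?_
  rw [inner_powA, inner_smul_right, incl_basis, inner_basis]
  split_ifs with h
  · rw [h]
  · simp

lemma continuous_powA (p : ℕ) : Continuous (S.powA p) :=
  continuous_iInf_dom (i := p) continuous_induced_dom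

/-- The topology of H is an infimum of induced ones, so convergence is tested on each A^p y, where
it is the basis expansion in H₀. -/
lemma hasSum_basis (y : S.Nucl) :
    HasSum (fun n => (inner ℝ (S.e n) (S.incl y) : ℝ) • S.basis n) y := by
  have h : 𝓝 y = ⨅ p, comap (S.powA p) (𝓝 (S.powA p y)) := by
    rw [nhds_iInf]
    simp_rw [nhds_induced]
  rw [HasSum, h, tendsto_iInf]
  intro p
  rw [tendsto_comap_iff]
  have h1 := S.e.hasSum_repr (S.powA p y)
  rw [HasSum] at h1
  refine h1.congr fun s => ?_
  rw [Function.comp_apply, map_sum]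
  refine Finset.sum_congr rfl fun n _ => ?_
  rw [map_smul, powA_basis, S.e.repr_apply_apply, inner_powA, smul_smul, mul_comm]

/-- The elements of `H'` are determined by their values on the basis vectors. -/
lemma dual_ext_basis {ω ω' : S.Dual} (h : ∀ n, ω (S.basis n) = ω' (S.basis n)) : ω = ω' := by
  ext y
  refine ((S.hasSum_basis y).mapL ω).unique ?_
  simpa only [map_smul, h] using (S.hasSum_basis y).mapL ω'

/-- The embedding of `H₋₂`, identified with `H₀` through the operator `A²`, into `H'`. -/
def emb (u : E) : S.Dual := (innerSL ℝ u).comp ⟨S.powA 2, S.continuous_powA 2⟩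

lemma emb_apply (u : E) (y : S.Nucl) : S.emb u y = inner ℝ u (S.powA 2 y) := rfl

lemma emb_add (u v : E) : S.emb (u + v) = S.emb u + S.emb v := by
  ext y
  simp [emb_apply, inner_add_left]

lemma continuous_emb : Continuous S.emb :=
  (ContinuousLinearMap.precomp ℝ (⟨S.powA 2, S.continuous_powA 2⟩ : S.Nucl →L[ℝ] E)).continuous.comp
    (innerSL ℝ).continuous

lemma emb_basis (u : E) (n : ℕ) : S.emb u (S.basis n) = S.ev n ^ 2 * inner ℝ (S.e n) u := by
  rw [emb_apply, powA_basis, inner_smul_right, real_inner_comm]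

lemma emb_injective : Function.Injective S.emb := fun u v h => by
  refine S.ext_coord fun n => ?_
  have := DFunLike.congr_fun h (S.basis n)
  rw [emb_basis, emb_basis] at this
  exact mul_left_cancel₀ (pow_ne_zero 2 (S.ev_pos n).ne') this

lemma measurable_eval (y : S.Nucl) : Measurable fun ω : S.Dual => ω y := by
  rw [measurable_iff_comap_le, BorelSpace.measurable_eq (α := ℝ)]
  exact le_iSup (fun y : S.Nucl => MeasurableSpace.comap (fun x : S.Dual => x y) (borel ℝ)) y

lemma measurableSpace_dual_eq_comap :
    S.instMeasurableSpaceDual =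
      MeasurableSpace.comap (fun (ω : S.Dual) (y : S.Nucl) => ω y) MeasurableSpace.pi := by
  rw [MeasurableSpace.pi, MeasurableSpace.comap_iSup]
  simp_rw [MeasurableSpace.comap_comp, BorelSpace.measurable_eq (α := ℝ)]
  rfl

lemma measurable_dual_iff {α : Type*} [MeasurableSpace α] {f : α → S.Dual} :
    Measurable f ↔ ∀ y, Measurable fun a => f a y := by
  refine ⟨fun h y => (S.measurable_eval y).comp h, fun h => ?_⟩
  rw [measurable_iff_comap_le, S.measurableSpace_dual_eq_comap, MeasurableSpace.comap_comp,
    ← measurable_iff_comap_le]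
  exact measurable_pi_lambda _ h

lemma measurable_emb [MeasurableSpace E] [BorelSpace E] : Measurable S.emb :=
  S.measurable_dual_iff.2 fun _ => Continuous.measurable (by simp only [emb_apply]; fun_prop)

/-- Countably many evaluations, at the basis vectors, already separate the points of H'. This is
what the Lusin–Souslin theorem needs of the target in `measurableEmbedding_emb`. -/
instance : MeasurableSpace.CountablySeparated S.Dual := by
  set g := fun (ω : S.Dual) (n : ℕ) => ω (S.basis n)
  have hg : Measurable g := measurable_pi_lambda _ fun n => S.measurable_eval _
  have hinj : Function.Injective g := fun ω ω' h => S.dual_ext_basis (congrFun h)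
  refine MeasurableSpace.CountablySeparated.mono (m := MeasurableSpace.comap g MeasurableSpace.pi)
    (hsep := ?_) hg.comap_le
  let _ : MeasurableSpace S.Dual := MeasurableSpace.comap g MeasurableSpace.pi
  have : MeasurableSpace.CountablyGenerated S.Dual := MeasurableSpace.CountablyGenerated.comap g
  have : MeasurableSpace.SeparatesPoints S.Dual := by
    refine ⟨fun ω ω' h => hinj ?_⟩
    have h1 := h (g ⁻¹' {g ω}) ⟨_, MeasurableSet.singleton _, rfl⟩ rfl
    exact (Set.mem_singleton_iff.1 h1).symm
  infer_instance

/-- Along a measurable embedding, integrability and integrals transfer without prior measurability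
of φ on H', which is only known to be continuous for the strong topology. -/
lemma measurableEmbedding_emb [MeasurableSpace E] [BorelSpace E] : MeasurableEmbedding S.emb := by
  have := S.secondCountableTopology
  exact S.measurable_emb.measurableEmbedding S.emb_injective

/-- A finite measure on `H'` is determined by its characteristic function. -/
theorem measure_dual_ext {μ ν : Measure S.Dual} [IsFiniteMeasure μ] [IsFiniteMeasure ν]
    (h : ∀ y : S.Nucl, ∫ x, Complex.exp (Complex.I * (x y : ℝ)) ∂μ =
      ∫ x, Complex.exp (Complex.I * (x y : ℝ)) ∂ν) : μ = ν := by
  set j := fun (ω : S.Dual) (y : S.Nucl) => ω y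
  have hj : Measurable j := measurable_pi_lambda _ S.measurable_eval
  have h1 : μ.map j = ν.map j := by
    -- A finite measure on a product is determined by its finite-dimensional marginals.
    refine IsProjectiveLimit.unique (P := fun I => (ν.map j).map I.restrict) (fun I => ?_)
      fun I => rfl
    beta_reduce
    rw [Measure.map_map (by fun_prop) hj, Measure.map_map (by fun_prop) hj]
    have hr : Measurable (I.restrict ∘ j) := (by fun_prop : Measurable I.restrict).comp hj
    refine Measure.ext_of_charFunDual (funext fun L => ?_)
    rw [charFunDual_apply, charFunDual_apply, integral_map hr.aemeasurable
      (Continuous.aestronglyMeasurable (by fun_prop)), integral_map hr.aemeasurable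
      (Continuous.aestronglyMeasurable (by fun_prop))]
    classical
    -- A functional L on ℝ^I becomes evaluation at one vector of H, so the given characteristic
    -- function contains the joint ones.
    convert h (∑ i : I, L (fun k => if i = k then 1 else 0) • i.1) using 3 with ω ω
    all_goals
      rw [mul_comm, map_sum, ← L.coe_coe, L.toLinearMap.pi_apply_eq_sum_univ]
      simp only [map_smul, smul_eq_mul, Function.comp_apply, Finset.restrict, mul_comm]
      rfl
  ext s hs
  rw [S.measurableSpace_dual_eq_comap] at hs
  obtain ⟨t, ht, rfl⟩ := hs
  rw [← Measure.map_apply hj ht, h1, Measure.map_apply hj ht]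

end WhiteNoise

/-! ### The operator A⁻² and the measures μ_{a+V} as images of Gaussian measures. -/

namespace WhiteNoise

variable {E : Type*} [NormedAddCommGroup E] [InnerProductSpace ℝ E] (S : WhiteNoise E)

/-- The operator `A⁻² : H₀ → H₀`. -/
def invSq : E →L[ℝ] E := ∑' n, (S.ev n ^ 2)⁻¹ • (innerSL ℝ (S.e n)).smulRight (S.e n)

lemma dense_of_forall_e_mem (D : Submodule ℝ E) (h : ∀ n, S.e n ∈ D) : Dense (D : Set E) := by
  rw [Submodule.dense_iff_topologicalClosure_eq_top, eq_top_iff, ← S.e.dense_span]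
  exact Submodule.topologicalClosure_mono (Submodule.span_le.2 (Set.range_subset_iff.2 h))

variable [CompleteSpace E]

lemma hasSum_invSq (u : E) :
    HasSum (fun n => ((S.ev n ^ 2)⁻¹ * inner ℝ (S.e n) u) • S.e n) (S.invSq u) := by
  have h : Summable fun n => (S.ev n ^ 2)⁻¹ • (innerSL ℝ (S.e n)).smulRight (S.e n) := by
    refine Summable.of_norm_bounded S.summable_ev fun n => ?_
    rw [norm_smul, ContinuousLinearMap.norm_smulRight_apply, innerSL_apply_norm,
      S.e.orthonormal.1 n, Real.norm_of_nonneg (inv_nonneg.2 (sq_nonneg _))]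
    simp
  have h1 := h.hasSum.mapL (ContinuousLinearMap.apply ℝ E u)
  simp only [ContinuousLinearMap.apply_apply, FunLike.coe_smul, Pi.smul_apply,
    ContinuousLinearMap.smulRight_apply, innerSL_apply_apply, smul_smul] at h1
  exact h1

lemma inner_invSq (n : ℕ) (u : E) :
    inner ℝ (S.e n) (S.invSq u) = (S.ev n ^ 2)⁻¹ * inner ℝ (S.e n) u := by
  have h := (S.hasSum_invSq u).mapL (innerSL ℝ (S.e n))
  have h1 (m : ℕ) : innerSL ℝ (S.e n) (((S.ev m ^ 2)⁻¹ * inner ℝ (S.e m) u) • S.e m) =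
      if m = n then (S.ev n ^ 2)⁻¹ * inner ℝ (S.e n) u else 0 := by
    rw [innerSL_apply_apply, inner_smul_right, S.inner_basis]
    split_ifs with h1 h2 h2
    · rw [h1, mul_one]
    · exact absurd h1.symm h2
    · exact absurd h2.symm h1
    · rw [mul_zero]
  simp only [h1] at h
  exact h.unique (hasSum_ite_eq n _)

lemma invSq_e (n : ℕ) : S.invSq (S.e n) = (S.ev n ^ 2)⁻¹ • S.e n := by
  refine S.ext_coord fun m => ?_
  rw [inner_invSq, inner_smul_right, inner_basis]
  split_ifs with h
  · rw [h]
  · simp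

lemma invSq_powA (y : S.Nucl) : S.invSq (S.powA 2 y) = S.incl y := by
  refine S.ext_coord fun m => ?_
  rw [inner_invSq, inner_powA, inv_mul_cancel_left₀ (pow_ne_zero 2 (S.ev_pos m).ne')]

lemma adjoint_invSq : S.invSq.adjoint = S.invSq := by
  refine ((ContinuousLinearMap.eq_adjoint_iff _ _).2 fun u v => ?_).symm
  rw [← S.e.tsum_inner_mul_inner, ← S.e.tsum_inner_mul_inner]
  refine tsum_congr fun n => ?_
  rw [real_inner_comm, inner_invSq, inner_invSq, real_inner_comm (S.e n) u]
  ring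

/-- A⁻² is self-adjoint and cancels A². Hence translation by a on H' is translation by A⁻² a on H₋₂.
-/
lemma emb_invSq (a : E) : S.emb (S.invSq a) = S.toDual a := by
  ext y
  rw [emb_apply, ← S.adjoint_invSq, ContinuousLinearMap.adjoint_inner_left, invSq_powA]
  rfl

lemma dense_range_powA : Dense (LinearMap.range (S.powA 2) : Set E) := by
  refine S.dense_of_forall_e_mem _ fun n => ⟨(S.ev n ^ 2)⁻¹ • S.basis n, ?_⟩
  rw [map_smul, powA_basis, smul_smul, inv_mul_cancel₀ (pow_ne_zero 2 (S.ev_pos n).ne'), one_smul]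

lemma denseRange_adjoint_invSq : DenseRange fun t => S.invSq.adjoint (S.invSq t) := by
  have h := S.dense_of_forall_e_mem (LinearMap.range (S.invSq.comp S.invSq).toLinearMap)
    fun n => ⟨(S.ev n ^ 2) • (S.ev n ^ 2) • S.e n, ?_⟩
  · rw [adjoint_invSq]
    exact h
  · have := pow_ne_zero 2 (S.ev_pos n).ne'
    simp only [ContinuousLinearMap.coe_coe, ContinuousLinearMap.comp_apply, map_smul, invSq_e,
      smul_smul]
    rw [mul_mul_mul_comm, mul_inv_cancel₀ this, one_mul, one_smul]

/-- There is a Gaussian measure on `H₋₂`, identified with `H₀`, whose translates induce the measures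
`μ_{a+V}` on `H'`. -/
theorem exists_gaussian_charFun_eq [MeasurableSpace E] [BorelSpace E] (V : Submodule ℝ E) :
    ∃ γ : Measure E, IsProbabilityMeasure γ ∧ ∀ t, charFun γ t =
      Complex.exp (-(‖(V.topologicalClosure.starProjection.comp S.invSq) t‖ ^ 2 : ℝ) / 2) := by
  refine exists_measure_charFun_eq S.e _ (Summable.of_nonneg_of_le (fun _ => norm_nonneg _)
    (fun n => ?_) S.summable_ev)
  -- A projection does not increase norms, so ‖P A⁻² eₙ‖ ≤ λₙ⁻².
  rw [ContinuousLinearMap.comp_apply, invSq_e, map_smul, norm_smul,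
    Real.norm_of_nonneg (inv_nonneg.2 (sq_nonneg _))]
  refine mul_le_of_le_one_right (inv_nonneg.2 (sq_nonneg _)) ?_
  exact (Submodule.norm_starProjection_apply_le _ _).trans (S.e.orthonormal.1 n).le

variable {S} in
theorem isAffineGaussian_map [MeasurableSpace E] [BorelSpace E] {V : Submodule ℝ E}
    {γ : Measure E} [IsProbabilityMeasure γ] (hγ : ∀ t, charFun γ t =
      Complex.exp (-(‖(V.topologicalClosure.starProjection.comp S.invSq) t‖ ^ 2 : ℝ) / 2)) (a : E) :
    S.IsAffineGaussian a V (γ.map fun u => S.emb (u + S.invSq a)) := by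
  have hm : Measurable fun u => S.emb (u + S.invSq a) := S.measurable_emb.comp (by fun_prop)
  refine ⟨Measure.isProbabilityMeasure_map hm.aemeasurable, fun y => ?_⟩
  have h1 : AEStronglyMeasurable (fun x : S.Dual => Complex.exp (Complex.I * (x y : ℝ)))
      (γ.map fun u => S.emb (u + S.invSq a)) :=
    ((by fun_prop : Measurable fun t : ℝ => Complex.exp (Complex.I * t)).comp
      (S.measurable_eval y)).aestronglyMeasurable
  have h2 := hγ (S.powA 2 y)
  rw [ContinuousLinearMap.comp_apply, invSq_powA, charFun_apply] at h2
  rw [integral_map hm.aemeasurable h1, sub_eq_add_neg, Complex.exp_add, ← neg_div, ← h2,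
    ← integral_const_mul]
  refine integral_congr_ae (ae_of_all _ fun u => ?_)
  simp only [emb_apply, inner_add_left]
  rw [← Complex.exp_add]
  congr 1
  rw [← S.adjoint_invSq, ContinuousLinearMap.adjoint_inner_left, invSq_powA]
  push_cast
  ring

theorem existsUnique_isAffineGaussian (a : E) (V : Submodule ℝ E) :
    ∃! ν : Measure S.Dual, S.IsAffineGaussian a V ν := by
  borelize E
  obtain ⟨γ, _, hγ⟩ := S.exists_gaussian_charFun_eq V
  refine ⟨_, isAffineGaussian_map hγ a, fun ν hν => ?_⟩
  have := hν.1
  have := (isAffineGaussian_map hγ a).1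
  exact S.measure_dual_ext fun y => (hν.2 y).trans ((isAffineGaussian_map hγ a).2 y).symm

lemma affineGaussian_eq [MeasurableSpace E] [BorelSpace E] {V : Submodule ℝ E}
    {γ : Measure E} [IsProbabilityMeasure γ] (hγ : ∀ t, charFun γ t =
      Complex.exp (-(‖(V.topologicalClosure.starProjection.comp S.invSq) t‖ ^ 2 : ℝ) / 2)) (a : E) :
    S.affineGaussian a V = γ.map fun u => S.emb (u + S.invSq a) :=
  (S.existsUnique_isAffineGaussian a V).unique
    (Classical.epsilon_spec (S.existsUnique_isAffineGaussian a V).exists) (isAffineGaussian_map hγ a)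

lemma isWhiteNoiseMeasure_iff (μ : Measure S.Dual) :
    S.IsWhiteNoiseMeasure μ ↔ S.IsAffineGaussian 0 ⊤ μ := by
  have h (x : E) : (⊤ : Submodule ℝ E).topologicalClosure.starProjection x = x :=
    Submodule.starProjection_eq_self_iff.2 (Submodule.le_topologicalClosure _ Submodule.mem_top)
  simp [IsWhiteNoiseMeasure, IsAffineGaussian, h, neg_div]

theorem existsUnique_isWhiteNoiseMeasure : ∃! μ : Measure S.Dual, S.IsWhiteNoiseMeasure μ := by
  simpa only [isWhiteNoiseMeasure_iff] using S.existsUnique_isAffineGaussian 0 ⊤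

/-- The white noise measure is induced by a Gaussian measure on `H₋₂`, identified with `H₀`. -/
theorem exists_gaussian_eq_map [MeasurableSpace E] [BorelSpace E] :
    ∃ γ : Measure E, IsProbabilityMeasure γ ∧
      (∀ t, charFun γ t = Complex.exp (-(‖S.invSq t‖ ^ 2 : ℝ) / 2)) ∧
      S.gaussian = γ.map S.emb := by
  obtain ⟨γ, hp, hγ⟩ := S.exists_gaussian_charFun_eq ⊤
  refine ⟨γ, hp, fun t => ?_, ?_⟩
  · rw [hγ, ContinuousLinearMap.comp_apply, Submodule.starProjection_eq_self_iff.2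
      (Submodule.le_topologicalClosure _ Submodule.mem_top)]
  · refine (S.existsUnique_isAffineGaussian 0 ⊤).unique ((S.isWhiteNoiseMeasure_iff _).1
      (Classical.epsilon_spec S.existsUnique_isWhiteNoiseMeasure.exists)) ?_
    simpa using isAffineGaussian_map hγ 0

end WhiteNoise

/-! ### Multi-index expansion of the exponential. -/

section PowerSums

variable {𝕜 : Type*} [RCLike 𝕜]

lemma summable_norm_and_hasSum_pi_prod {b : ℕ → 𝕜} (hb : Summable fun n => ‖b n‖) (n : ℕ) :
    (Summable fun i : Fin n → ℕ => ‖∏ j, b (i j)‖) ∧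
      HasSum (fun i : Fin n → ℕ => ∏ j, b (i j)) ((∑' m, b m) ^ n) := by
  induction n with
  | zero =>
    refine ⟨(hasSum_unique _).summable, ?_⟩
    convert hasSum_unique (fun i : Fin 0 → ℕ => ∏ j, b (i j))
    simp
  | succ n ih =>
    have h (x : ℕ × (Fin n → ℕ)) :
        ∏ j, b (Fin.consEquiv (fun _ => ℕ) x j) = b x.1 * ∏ j, b (x.2 j) := by
      simp [Fin.prod_univ_succ, Fin.consEquiv]
    constructor
    · rw [← (Fin.consEquiv fun _ : Fin (n + 1) => ℕ).summable_iff]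
      refine (hb.mul_norm ih.1).congr fun x => ?_
      rw [Function.comp_apply, h]
    · rw [← (Fin.consEquiv fun _ : Fin (n + 1) => ℕ).hasSum_iff, pow_succ']
      have := hb.of_norm.hasSum.mul ih.2 (hb.mul_norm ih.1).of_norm
      rwa [← funext h] at this

lemma summable_norm_and_hasSum_exp {b : ℕ → 𝕜} (hb : Summable fun n => ‖b n‖) :
    (Summable fun k : Σ n : ℕ, (Fin n → ℕ) => ‖(k.1.factorial : 𝕜)⁻¹ * ∏ j, b (k.2 j)‖) ∧
      HasSum (fun k : Σ n : ℕ, (Fin n → ℕ) => (k.1.factorial : 𝕜)⁻¹ * ∏ j, b (k.2 j))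
        (NormedSpace.exp (∑' m, b m)) := by
  have h1 : Summable fun k : Σ n : ℕ, (Fin n → ℕ) =>
      ‖(k.1.factorial : 𝕜)⁻¹ * ∏ j, b (k.2 j)‖ := by
    refine (summable_sigma_of_nonneg fun _ => norm_nonneg _).2 ⟨fun n => ?_, ?_⟩
    · simp_rw [norm_mul]
      exact (summable_norm_and_hasSum_pi_prod hb n).1.mul_left _
    · have hb' : Summable fun n => ‖‖b n‖‖ := by simpa using hb
      refine (NormedSpace.expSeries_div_hasSum_exp (𝔸 := ℝ) (∑' m, ‖b m‖)).summable.congr fun n => ?_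
      simp_rw [norm_mul, tsum_mul_left, norm_prod]
      rw [(summable_norm_and_hasSum_pi_prod hb' n).2.tsum_eq]
      simp [div_eq_inv_mul]
  refine ⟨h1, HasSum.sigma_of_hasSum (NormedSpace.expSeries_div_hasSum_exp (𝔸 := 𝕜) (∑' m, b m))
    (fun n => ?_) h1.of_norm⟩
  rw [div_eq_inv_mul]
  exact (summable_norm_and_hasSum_pi_prod hb n).2.mul_left _

end PowerSums

/-! ### Cauchy–Schwarz estimates on Fock space. -/

namespace WhiteNoise

variable {E : Type*} [NormedAddCommGroup E] [InnerProductSpace ℝ E] (S : WhiteNoise E)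

/-- The terms of the series that defines the squared norm of the Fock space over `H_p`. -/
def fockTerm (p : ℕ) (f : Tensors) (k : Σ n : ℕ, (Fin n → ℕ)) : ℝ :=
  k.1.factorial * (∏ j, S.ev (k.2 j) ^ (2 * p)) * ‖f k‖ ^ 2

lemma prod_ev_pos (p : ℕ) {n : ℕ} (i : Fin n → ℕ) : 0 < ∏ j, S.ev (i j) ^ p :=
  Finset.prod_pos fun j _ => pow_pos (S.ev_pos (i j)) _

lemma fockTerm_nonneg (p : ℕ) (f : Tensors) (k : Σ n : ℕ, (Fin n → ℕ)) : 0 ≤ S.fockTerm p f k := by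
  have := S.prod_ev_pos (2 * p) k.2
  unfold fockTerm
  positivity

lemma fockNormSq_eq_tsum_ofReal (p : ℕ) (f : Tensors) :
    S.fockNormSq p f = ∑' k, ENNReal.ofReal (S.fockTerm p f k) := by
  refine tsum_congr fun k => ?_
  have := S.prod_ev_pos (2 * p) k.2
  rw [fockTerm, ENNReal.ofReal_mul (by positivity), ENNReal.ofReal_mul (by positivity),
    ENNReal.ofReal_natCast, ENNReal.ofReal_pow (norm_nonneg _), ofReal_norm]

lemma summable_fockTerm {p : ℕ} {f : Tensors} (hf : S.fockNormSq p f < ∞) :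
    Summable (S.fockTerm p f) := by
  rw [fockNormSq_eq_tsum_ofReal] at hf
  refine (ENNReal.summable_toReal hf.ne).congr fun k => ?_
  rw [ENNReal.toReal_ofReal (S.fockTerm_nonneg p f k)]

lemma tsum_fockTerm {p : ℕ} {f : Tensors} (hf : S.fockNormSq p f < ∞) :
    ∑' k, S.fockTerm p f k = (S.fockNormSq p f).toReal := by
  rw [fockNormSq_eq_tsum_ofReal, ← ENNReal.ofReal_tsum_of_nonneg (S.fockTerm_nonneg p f)
    (S.summable_fockTerm hf), ENNReal.toReal_ofReal (tsum_nonneg (S.fockTerm_nonneg p f))]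

/-- This is the arithmetic–geometric mean inequality, the difference of the two sides being a
square. The free parameter t lets a small Fock norm force a small sum. -/
lemma norm_mul_prod_le_fockTerm (p : ℕ) (f : Tensors) {b : ℕ → ℝ} {t : ℝ} (ht : 0 < t)
    (k : Σ n : ℕ, (Fin n → ℕ)) :
    ‖f k‖ * ∏ j, b (k.2 j) ≤ 2⁻¹ * (t * S.fockTerm p f k +
      t⁻¹ * ((k.1.factorial : ℝ)⁻¹ * ∏ j, (S.ev (k.2 j) ^ (2 * p))⁻¹ * b (k.2 j) ^ 2)) := by
  have h1 := S.prod_ev_pos (2 * p) k.2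
  rw [fockTerm, Finset.prod_mul_distrib, Finset.prod_inv_distrib, Finset.prod_pow _ 2]
  set P := ∏ j, S.ev (k.2 j) ^ (2 * p)
  set Q := ∏ j, b (k.2 j)
  have h2 : (0 : ℝ) < k.1.factorial := by exact_mod_cast k.1.factorial_pos
  set N := (k.1.factorial : ℝ)
  have h3 : 2⁻¹ * (t * (N * P * ‖f k‖ ^ 2) + t⁻¹ * (N⁻¹ * (P⁻¹ * Q ^ 2))) - ‖f k‖ * Q =
      2⁻¹ * (t * N * P) * (‖f k‖ - Q / (t * N * P)) ^ 2 := by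
    field_simp
    ring
  have h4 : 0 ≤ 2⁻¹ * (t * N * P) * (‖f k‖ - Q / (t * N * P)) ^ 2 := by positivity
  linarith

/-- A weighted Cauchy–Schwarz inequality for the Fock space over `H_p`. -/
lemma summable_norm_mul_prod_and_tsum_le {p : ℕ} {f : Tensors} (hf : S.fockNormSq p f < ∞)
    {b : ℕ → ℝ} (hb0 : ∀ n, 0 ≤ b n) (hb : Summable fun n => (S.ev n ^ (2 * p))⁻¹ * b n ^ 2)
    {t : ℝ} (ht : 0 < t) :
    (Summable fun k : Σ n : ℕ, (Fin n → ℕ) => ‖f k‖ * ∏ j, b (k.2 j)) ∧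
      ∑' k : Σ n : ℕ, (Fin n → ℕ), ‖f k‖ * ∏ j, b (k.2 j) ≤ 2⁻¹ * (t * (S.fockNormSq p f).toReal +
        t⁻¹ * Real.exp (∑' n, (S.ev n ^ (2 * p))⁻¹ * b n ^ 2)) := by
  have hb' : Summable fun n => ‖(S.ev n ^ (2 * p))⁻¹ * b n ^ 2‖ := hb.norm
  have h1 := (summable_norm_and_hasSum_exp hb').2
  rw [← Real.exp_eq_exp_ℝ, ← S.tsum_fockTerm hf] at *
  have h2 := (((S.summable_fockTerm hf).hasSum.mul_left t).add (h1.mul_left t⁻¹)).mul_left 2⁻¹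
  have h3 : Summable fun k : Σ n : ℕ, (Fin n → ℕ) => ‖f k‖ * ∏ j, b (k.2 j) :=
    Summable.of_nonneg_of_le
      (fun k => mul_nonneg (norm_nonneg _) (Finset.prod_nonneg fun j _ => hb0 _))
      (fun k => S.norm_mul_prod_le_fockTerm p f ht k) h2.summable
  exact ⟨h3, hasSum_le (fun k => S.norm_mul_prod_le_fockTerm p f ht k) h3.hasSum h2⟩

/-- The value `∑ₙ ⟨fₙ, z^{⊗ n}⟩` of the entire function defined by `f` at the point with the
coordinates `z`. -/
def tensorEval (f : Tensors) (z : ℕ → ℂ) : ℂ :=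
  ∑' k : Σ n : ℕ, (Fin n → ℕ), f k * ∏ j, z (k.2 j)

lemma norm_tensor_mul_prod_le (f : Tensors) {z : ℕ → ℂ} {b : ℕ → ℝ} (hz : ∀ n, ‖z n‖ ≤ b n)
    (k : Σ n : ℕ, (Fin n → ℕ)) : ‖f k * ∏ j, z (k.2 j)‖ ≤ ‖f k‖ * ∏ j, b (k.2 j) := by
  rw [norm_mul, norm_prod]
  exact mul_le_mul_of_nonneg_left
    (Finset.prod_le_prod (fun _ _ => norm_nonneg _) fun _ _ => hz _) (norm_nonneg _)

lemma norm_tensorEval_le {p : ℕ} {f : Tensors} (hf : S.fockNormSq p f < ∞) {z : ℕ → ℂ}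
    {b : ℕ → ℝ} (hz : ∀ n, ‖z n‖ ≤ b n)
    (hb : Summable fun n => (S.ev n ^ (2 * p))⁻¹ * b n ^ 2) {t : ℝ} (ht : 0 < t) :
    ‖tensorEval f z‖ ≤ 2⁻¹ * (t * (S.fockNormSq p f).toReal +
        t⁻¹ * Real.exp (∑' n, (S.ev n ^ (2 * p))⁻¹ * b n ^ 2)) := by
  have h := S.summable_norm_mul_prod_and_tsum_le hf (fun n => (norm_nonneg _).trans (hz n)) hb ht
  exact (tsum_of_norm_bounded h.1.hasSum fun k => norm_tensor_mul_prod_le f hz k).trans h.2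

end WhiteNoise

/-! ### The S-transform of I f. -/

lemma norm_integral_mul_le_eLpNorm {α : Type*} [MeasurableSpace α] {μ : Measure α} {F G : α → ℂ}
    (hF : MemLp F 2 μ) (hG : MemLp G 2 μ) :
    ‖∫ x, F x * G x ∂μ‖ ≤ (eLpNorm F 2 μ).toReal * (eLpNorm G 2 μ).toReal := by
  rw [← ENNReal.toReal_mul, ← toReal_enorm]
  refine ENNReal.toReal_mono (ENNReal.mul_ne_top hF.2.ne hG.2.ne) ?_
  refine (enorm_integral_le_lintegral_enorm _).trans ?_
  rw [← eLpNorm_one_eq_lintegral_enorm]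
  change eLpNorm (F • G) 1 μ ≤ _
  exact eLpNorm_smul_le_mul_eLpNorm hG.1 hF.1

lemma linearCombination_apply_apply {X A : Type*} (g : X → A → ℂ) (c : X →₀ ℂ) (a : A) :
    Finsupp.linearCombination ℂ g c a = ∑ x ∈ c.support, c x * g x a := by
  simp [Finsupp.linearCombination_apply, Finsupp.sum, Finset.sum_apply]

namespace WhiteNoise

variable {E : Type*} [NormedAddCommGroup E] [InnerProductSpace ℝ E] (S : WhiteNoise E)

/-- The coordinates of a vector with respect to the basis, as complex numbers. -/
def coord (x : E) (n : ℕ) : ℂ := (inner ℝ (S.e n) x : ℝ)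

lemma norm_coord (x : E) (n : ℕ) : ‖S.coord x n‖ = |inner ℝ (S.e n) x| := by
  rw [coord, Complex.norm_real, Real.norm_eq_abs]

lemma hasSum_coord_sq [CompleteSpace E] (x : E) :
    HasSum (fun n => (inner ℝ (S.e n) x) ^ 2) (‖x‖ ^ 2) := by
  have := S.e.hasSum_inner_mul_inner x x
  rw [real_inner_self_eq_norm_sq] at this
  simpa only [sq, real_inner_comm] using this

lemma hasSum_expTensor_mul_prod_coord [CompleteSpace E] (x y : S.Nucl) :
    HasSum (fun k : Σ n : ℕ, (Fin n → ℕ) => S.expTensor x k * ∏ j, S.coord (S.incl y) (k.2 j))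
      (Complex.exp (inner ℝ (S.incl x) (S.incl y) : ℝ)) := by
  have h1 := S.e.hasSum_inner_mul_inner (S.incl x) (S.incl y)
  have h2 : HasSum (fun n => S.coord (S.incl x) n * S.coord (S.incl y) n)
      (inner ℝ (S.incl x) (S.incl y) : ℝ) := by
    simpa [coord, real_inner_comm] using Complex.hasSum_ofReal.2 h1
  have h3 := (summable_norm_and_hasSum_exp h2.summable.norm).2
  rw [h2.tsum_eq, ← Complex.exp_eq_exp_ℂ] at h3
  have h4 (k : Σ n : ℕ, (Fin n → ℕ)) : S.expTensor x k * ∏ j, S.coord (S.incl y) (k.2 j) =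
      (k.1.factorial : ℂ)⁻¹ * ∏ j, (S.coord (S.incl x) (k.2 j) * S.coord (S.incl y) (k.2 j)) := by
    simp only [expTensor, Finset.prod_mul_distrib, coord]
    push_cast
    ring
  simpa only [h4] using h3

variable [CompleteSpace E]

lemma expFun_emb (x : S.Nucl) (u : E) :
    S.expFun x (S.emb u) =
      ((Real.exp (inner ℝ u (S.powA 2 x)) * Real.exp (-(‖S.incl x‖ ^ 2 / 2)) : ℝ) : ℂ) := by
  rw [expFun, emb_apply, ← Real.exp_add, Complex.ofReal_exp, sub_eq_add_neg]

variable [MeasurableSpace E] [BorelSpace E] {γ : Measure E} [IsProbabilityMeasure γ]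

variable {S} in
lemma memLp_expFun_emb (hγ : ∀ t, charFun γ t = Complex.exp (-(‖S.invSq t‖ ^ 2 : ℝ) / 2))
    (x : S.Nucl) : MemLp (fun u => S.expFun x (S.emb u)) 2 γ := by
  simp_rw [expFun_emb]
  exact ((memLp_exp_inner hγ (S.powA 2 x)).mul_const _).ofReal

-- After the normalizations only the cross term of |x + y|₀² is left. Together with
-- `hasSum_expTensor_mul_prod_coord` this is the S-transform formula for the spanning vectors Exp x.
variable {S} in
lemma integral_expFun_mul_expFun
    (hγ : ∀ t, charFun γ t = Complex.exp (-(‖S.invSq t‖ ^ 2 : ℝ) / 2)) (x y : S.Nucl) :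
    ∫ u, S.expFun x (S.emb u) * S.expFun y (S.emb u) ∂γ =
      Complex.exp (inner ℝ (S.incl x) (S.incl y) : ℝ) := by
  have h1 (u : E) : S.expFun x (S.emb u) * S.expFun y (S.emb u) =
      ((Real.exp (inner ℝ u (S.powA 2 (x + y))) *
        Real.exp (-(‖S.incl x‖ ^ 2 / 2) + -(‖S.incl y‖ ^ 2 / 2)) : ℝ) : ℂ) := by
    rw [expFun_emb, expFun_emb, map_add, inner_add_right, ← Complex.ofReal_mul]
    simp only [Real.exp_add]
    ring_nf
  simp_rw [h1]
  rw [integral_complex_ofReal, integral_mul_const, integral_exp_inner hγ, invSq_powA, map_add,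
    ← Real.exp_add, norm_add_sq_real, ← Complex.ofReal_exp]
  congr 2
  ring

variable {S} in
/-- The `S`-transform of `I f` is given by the entire function defined by `f`. -/
theorem integral_mul_expFun_of_isWienerIto
    (hγ : ∀ t, charFun γ t = Complex.exp (-(‖S.invSq t‖ ^ 2 : ℝ) / 2))
    (hμ : S.gaussian = γ.map S.emb) {f : Tensors} {F : S.Dual → ℂ} (h : S.IsWienerIto f F)
    (y : S.Nucl) :
    ∫ u, F (S.emb u) * S.expFun y (S.emb u) ∂γ = tensorEval f (S.coord (S.incl y)) := by
  obtain ⟨hf, hF, happ⟩ := h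
  rw [hμ] at hF happ
  have hmp : MeasurePreserving S.emb γ (γ.map S.emb) := ⟨S.measurable_emb, rfl⟩
  have hF' : MemLp (fun u => F (S.emb u)) 2 γ := hF.comp_measurePreserving hmp
  have hG := memLp_expFun_emb hγ y
  have hmul {H : E → ℂ} (hH : MemLp H 2 γ) :
      Integrable (fun u => H u * S.expFun y (S.emb u)) γ := hH.integrable_mul hG
  set K := (eLpNorm (fun u => S.expFun y (S.emb u)) 2 γ).toReal
  set K' := Real.exp (∑' n, (S.ev n ^ (2 * 0))⁻¹ * |inner ℝ (S.e n) (S.incl y)| ^ 2)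
  have hK' : Summable fun n => (S.ev n ^ (2 * 0))⁻¹ * |inner ℝ (S.e n) (S.incl y)| ^ 2 := by
    simpa using (S.hasSum_coord_sq (S.incl y)).summable
  have key (t : ℝ) (ht : 1 ≤ t) :
      ‖∫ u, F (S.emb u) * S.expFun y (S.emb u) ∂γ - tensorEval f (S.coord (S.incl y))‖ ≤
        (K + 2⁻¹ * (1 + K')) * t⁻¹ := by
    have ht0 : 0 < t := zero_lt_one.trans_le ht
    -- With accuracy t⁻², the Fock estimate with parameter t has error of order t · t⁻² + t⁻¹, which
    -- vanishes as t → ∞.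
    obtain ⟨c, hc1, hc2⟩ := happ (ENNReal.ofReal (t⁻¹ ^ 2)) (by simpa using by positivity)
    have hL : MemLp (fun u => Finsupp.linearCombination ℂ S.expFun c (S.emb u)) 2 γ := by
      simp only [linearCombination_apply_apply]
      exact memLp_finsetSum _ fun x _ => (memLp_expFun_emb hγ x).const_mul (c x)
    have hLs : HasSum (fun k : Σ n : ℕ, (Fin n → ℕ) =>
        Finsupp.linearCombination ℂ S.expTensor c k * ∏ j, S.coord (S.incl y) (k.2 j))
        (∑ x ∈ c.support, c x * Complex.exp (inner ℝ (S.incl x) (S.incl y) : ℝ)) := by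
      simp only [linearCombination_apply_apply, Finset.sum_mul, mul_assoc]
      exact hasSum_sum fun x _ => (S.hasSum_expTensor_mul_prod_coord x y).mul_left (c x)
    have hLi : ∫ u, Finsupp.linearCombination ℂ S.expFun c (S.emb u) * S.expFun y (S.emb u) ∂γ =
        tensorEval (Finsupp.linearCombination ℂ S.expTensor c) (S.coord (S.incl y)) := by
      rw [tensorEval, hLs.tsum_eq]
      simp only [linearCombination_apply_apply, Finset.sum_mul, mul_assoc]
      rw [integral_finsetSum _ fun x _ =>
        (hmul (memLp_expFun_emb hγ x)).const_mul (c x)]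
      exact Finset.sum_congr rfl fun x _ => by
        rw [integral_const_mul, integral_expFun_mul_expFun hγ]
    have h1 : ‖∫ u, F (S.emb u) * S.expFun y (S.emb u) ∂γ -
        ∫ u, Finsupp.linearCombination ℂ S.expFun c (S.emb u) * S.expFun y (S.emb u) ∂γ‖ ≤
        t⁻¹ ^ 2 * K := by
      rw [← integral_sub (hmul hF') (hmul hL)]
      simp only [← sub_mul]
      refine (norm_integral_mul_le_eLpNorm (hF'.sub hL) hG).trans ?_
      gcongr
      rw [S.measurableEmbedding_emb.eLpNorm_map_measure] at hc2
      exact ENNReal.toReal_le_of_le_ofReal (by positivity) hc2.le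
    have h2 : ‖tensorEval (f - Finsupp.linearCombination ℂ S.expTensor c) (S.coord (S.incl y))‖ ≤
        2⁻¹ * (t * t⁻¹ ^ 2 + t⁻¹ * K') := by
      refine (S.norm_tensorEval_le (hc1.trans ENNReal.ofReal_lt_top)
        (fun n => (S.norm_coord _ n).le) hK' ht0).trans ?_
      gcongr
      exact ENNReal.toReal_le_of_le_ofReal (by positivity) hc1.le
    have h3 : tensorEval (f - Finsupp.linearCombination ℂ S.expTensor c) (S.coord (S.incl y)) =
        tensorEval f (S.coord (S.incl y)) -
        tensorEval (Finsupp.linearCombination ℂ S.expTensor c) (S.coord (S.incl y)) := by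
      have hfs : Summable fun k : Σ n : ℕ, (Fin n → ℕ) => f k * ∏ j, S.coord (S.incl y) (k.2 j) :=
        Summable.of_norm_bounded
          (S.summable_norm_mul_prod_and_tsum_le hf.2 (fun n => abs_nonneg _) hK' ht0).1
          (norm_tensor_mul_prod_le f fun n => (S.norm_coord _ n).le)
      rw [tensorEval, tensorEval, tensorEval, ← hfs.tsum_sub hLs.summable]
      simp only [Pi.sub_apply, sub_mul]
    rw [hLi] at h1
    have h4 : t⁻¹ ^ 2 ≤ t⁻¹ := by
      rw [sq]
      exact mul_le_of_le_one_left (by positivity) (inv_le_one_of_one_le₀ ht)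
    have h5 : t * t⁻¹ ^ 2 = t⁻¹ := by field_simp
    have h6 : 0 ≤ K := ENNReal.toReal_nonneg
    calc _ ≤ t⁻¹ ^ 2 * K + 2⁻¹ * (t * t⁻¹ ^ 2 + t⁻¹ * K') := by
          rw [h3, norm_sub_rev] at h2
          exact (norm_sub_le_norm_sub_add_norm_sub _ _ _).trans (add_le_add h1 h2)
      _ ≤ _ := by
          rw [h5]
          nlinarith
  have h1 : Tendsto (fun t : ℝ => (K + 2⁻¹ * (1 + K')) * t⁻¹) atTop (𝓝 0) := by
    simpa using tendsto_inv_atTop_zero.const_mul (K + 2⁻¹ * (1 + K'))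
  have h2 := ge_of_tendsto h1 ((eventually_ge_atTop 1).mono key)
  exact sub_eq_zero.1 (norm_le_zero_iff.1 h2)

end WhiteNoise

/-! ### Injectivity of the Laplace transform on L². -/

/-- A square integrable function all of whose Laplace transforms against a Gaussian measure
vanish is zero. -/
theorem ae_eq_zero_of_integral_mul_exp_inner {E : Type*} [NormedAddCommGroup E]
    [InnerProductSpace ℝ E] [CompleteSpace E] [SecondCountableTopology E] [MeasurableSpace E]
    [BorelSpace E] {γ : Measure E} [IsProbabilityMeasure γ] {T : E →L[ℝ] E}
    (hγ : ∀ t, charFun γ t = Complex.exp (-(‖T t‖ ^ 2 : ℝ) / 2))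
    (D : Submodule ℝ E) (hD : Dense (D : Set E)) {h : E → ℝ} (hh : MemLp h 2 γ)
    (h0 : ∀ t ∈ D, ∫ u, h u * Real.exp (inner ℝ u t) ∂γ = 0) : h =ᵐ[γ] 0 := by
  have hint : Integrable h γ := hh.integrable (by norm_num)
  have key {g : E → ℝ} (hg : MemLp g 2 γ) (t : E) :
      Integrable (fun u => Real.exp (inner ℝ u t)) (γ.withDensity fun u => ENNReal.ofReal (g u)) ∧
      ∫ u, Real.exp (inner ℝ u t) ∂(γ.withDensity fun u => ENNReal.ofReal (g u)) =
        ∫ u, max (g u) 0 * Real.exp (inner ℝ u t) ∂γ := by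
    have hm : AEMeasurable (fun u => ENNReal.ofReal (g u)) γ := hg.1.aemeasurable.ennreal_ofReal
    constructor
    · rw [integrable_withDensity_iff_integrable_smul₀' hm (by simp)]
      simp only [ENNReal.toReal_ofReal', smul_eq_mul]
      exact hg.pos_part.integrable_mul (memLp_exp_inner hγ t)
    · rw [integral_withDensity_eq_integral_toReal_smul₀ hm (by simp)]
      simp only [ENNReal.toReal_ofReal', smul_eq_mul]
  have f1 := isFiniteMeasure_withDensity_ofReal hint.2
  have f2 := isFiniteMeasure_withDensity_ofReal hint.neg.2
  -- The positive and negative parts of h are densities of finite measures with equal Laplace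
  -- transforms, so the two measures coincide.
  have heq : γ.withDensity (fun u => ENNReal.ofReal (h u)) =
      γ.withDensity fun u => ENNReal.ofReal ((-h) u) := by
    refine Measure.ext_of_integral_exp_inner D hD (fun t _ => (key hh t).1) fun t ht => ?_
    have hmul {g : E → ℝ} (hg : MemLp g 2 γ) :
        Integrable (fun u => max (g u) 0 * Real.exp (inner ℝ u t)) γ :=
      hg.pos_part.integrable_mul (memLp_exp_inner hγ t)
    rw [(key hh t).2, (key hh.neg t).2, ← sub_eq_zero, ← integral_sub (hmul hh) (hmul hh.neg)]
    refine Eq.trans ?_ (h0 t ht)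
    refine integral_congr_ae (ae_of_all _ fun u => ?_)
    simp only [Pi.neg_apply, ← sub_mul]
    rw [max_zero_sub_max_neg_zero_eq_self]
  rw [withDensity_eq_iff hh.1.aemeasurable.ennreal_ofReal hh.neg.1.aemeasurable.ennreal_ofReal
    hint.lintegral_lt_top.ne] at heq
  filter_upwards [heq] with u hu
  rcases lt_trichotomy (h u) 0 with h1 | h1 | h1
  · have : 0 < ENNReal.ofReal ((-h) u) := by simpa using h1
    rw [← hu, ENNReal.ofReal_pos] at this
    exact absurd this h1.not_gt
  · exact h1
  · have : 0 < ENNReal.ofReal (h u) := by simpa using h1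
    rw [hu, ENNReal.ofReal_pos, Pi.neg_apply] at this
    linarith

/-! ### Growth and continuity of the entire function on the complexified H₋₂. -/

namespace WhiteNoise

variable {E : Type*} [NormedAddCommGroup E] [InnerProductSpace ℝ E] (S : WhiteNoise E)

/-- The coordinates of the point `A² u + i A² v` of the complexification of `H₋₂`. -/
def cpt (q : E × E) (n : ℕ) : ℂ :=
  S.ev n ^ 2 * ((inner ℝ (S.e n) q.1 : ℝ) + (inner ℝ (S.e n) q.2 : ℝ) * Complex.I)

lemma continuous_cpt (n : ℕ) : Continuous fun q => S.cpt q n := by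
  unfold cpt
  fun_prop

lemma norm_cpt_le (q : E × E) (n : ℕ) : ‖S.cpt q n‖ ≤ S.ev n ^ 2 * (‖q.1‖ + ‖q.2‖) := by
  have h (x : E) : ‖((inner ℝ (S.e n) x : ℝ) : ℂ)‖ ≤ ‖x‖ := by
    rw [Complex.norm_real]
    simpa [S.e.orthonormal.1 n] using norm_inner_le_norm (𝕜 := ℝ) (S.e n) x
  rw [cpt, norm_mul, norm_pow, Complex.norm_real, Real.norm_of_nonneg (S.ev_pos n).le]
  gcongr
  refine (norm_add_le _ _).trans (add_le_add (h _) ?_)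
  simpa using h q.2

/-- The squared Hilbert–Schmidt norm of the inclusion `H₋₂ → H_{-(p+3)}`. -/
def hsWeight (p : ℕ) : ℝ := ∑' n, (S.ev n ^ (2 * (p + 3)))⁻¹ * (S.ev n ^ 2) ^ 2

/-- The shift by 3 spends λₙ⁴ on passing to H₋₂ and λₙ² on summability. The remaining λₙ^{-2p} is at
most λ₀^{-2p}, λ₀ being the least eigenvalue. -/
lemma weight_le (p n : ℕ) : (S.ev n ^ (2 * (p + 3)))⁻¹ * (S.ev n ^ 2) ^ 2 ≤
    ((S.ev 0 ^ 2)⁻¹) ^ p * (S.ev n ^ 2)⁻¹ := by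
  have h0 := S.ev_pos 0
  have hn := S.ev_pos n
  have h1 : (S.ev n ^ (2 * (p + 3)))⁻¹ * (S.ev n ^ 2) ^ 2 =
      ((S.ev n ^ 2)⁻¹) ^ p * (S.ev n ^ 2)⁻¹ := by
    rw [pow_mul, inv_pow, pow_add]
    field_simp
  rw [h1]
  have h2 : S.ev 0 ≤ S.ev n := S.ev_strictMono.monotone (Nat.zero_le n)
  gcongr

lemma summable_weight (p : ℕ) :
    Summable fun n => (S.ev n ^ (2 * (p + 3)))⁻¹ * (S.ev n ^ 2) ^ 2 := by
  refine Summable.of_nonneg_of_le (fun n => ?_) (S.weight_le p) (S.summable_ev.mul_left _)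
  have hn := S.ev_pos n
  positivity

lemma hsWeight_nonneg (p : ℕ) : 0 ≤ S.hsWeight p := tsum_nonneg fun n => by
  have hn := S.ev_pos n
  positivity

lemma exists_hsWeight_le {c : ℝ} (hc : 0 < c) : ∃ p, S.hsWeight p ≤ c := by
  have h1 (p : ℕ) : S.hsWeight p ≤ ((S.ev 0 ^ 2)⁻¹) ^ p * ∑' n, (S.ev n ^ 2)⁻¹ := by
    rw [← tsum_mul_left]
    exact (S.summable_weight p).tsum_le_tsum (S.weight_le p) (S.summable_ev.mul_left _)
  have h2 : Tendsto (fun p : ℕ => ((S.ev 0 ^ 2)⁻¹) ^ p * ∑' n, (S.ev n ^ 2)⁻¹) atTop (𝓝 0) := by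
    have := S.one_lt_ev 0
    have := S.ev_pos 0
    simpa using (tendsto_pow_atTop_nhds_zero_of_lt_one (r := (S.ev 0 ^ 2)⁻¹) (by positivity)
      (inv_lt_one_of_one_lt₀ (one_lt_pow₀ (S.one_lt_ev 0) two_ne_zero))).mul_const
        (∑' n, (S.ev n ^ 2)⁻¹)
  obtain ⟨p, hp⟩ := (h2.eventually (gt_mem_nhds hc)).exists
  exact ⟨p, (h1 p).trans hp.le⟩

variable {S} {p : ℕ} {f : Tensors}

lemma summable_majorant_and_tsum_le (hf : S.fockNormSq (p + 3) f < ∞) {R : ℝ} (hR : 0 ≤ R) :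
    (Summable fun k : Σ n : ℕ, (Fin n → ℕ) => ‖f k‖ * ∏ j, (S.ev (k.2 j) ^ 2 * R)) ∧
      ∑' k : Σ n : ℕ, (Fin n → ℕ), ‖f k‖ * ∏ j, (S.ev (k.2 j) ^ 2 * R) ≤
        2⁻¹ * ((S.fockNormSq (p + 3) f).toReal + Real.exp (S.hsWeight p * R ^ 2)) := by
  have h := S.summable_norm_mul_prod_and_tsum_le hf (b := fun n => S.ev n ^ 2 * R)
    (fun n => by positivity)
    (by simpa only [mul_pow, mul_assoc] using (S.summable_weight p).mul_right (R ^ 2)) one_pos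
  simp only [mul_pow, ← mul_assoc, tsum_mul_right, inv_one, one_mul] at h
  simpa only [hsWeight, mul_assoc] using h

/-- A constant in the growth estimate for the elements of `[H]_{p+3}`. -/
def fockConst (S : WhiteNoise E) (p : ℕ) (f : Tensors) : ℝ :=
  2⁻¹ * ((S.fockNormSq (p + 3) f).toReal + 1)

lemma fockConst_nonneg : 0 ≤ S.fockConst p f := by
  have : 0 ≤ (S.fockNormSq (p + 3) f).toReal := ENNReal.toReal_nonneg
  unfold fockConst
  positivity

/-- The bound (r + s)² ≤ 2r² + 2s² separates the real and imaginary parts. The summand 1 in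
`fockConst` absorbs the exponential, since X + e^y ≤ (X + 1) e^y for X, y ≥ 0. -/
lemma tsum_majorant_le (hf : S.fockNormSq (p + 3) f < ∞) {r s : ℝ} (hr : 0 ≤ r) (hs : 0 ≤ s) :
    ∑' k : Σ n : ℕ, (Fin n → ℕ), ‖f k‖ * ∏ j, (S.ev (k.2 j) ^ 2 * (r + s)) ≤
      S.fockConst p f * (Real.exp (2 * S.hsWeight p * r ^ 2) *
        Real.exp (2 * S.hsWeight p * s ^ 2)) := by
  refine (summable_majorant_and_tsum_le hf (add_nonneg hr hs)).2.trans ?_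
  have hw := S.hsWeight_nonneg p
  have h1 : S.hsWeight p * (r + s) ^ 2 ≤
      2 * S.hsWeight p * r ^ 2 + 2 * S.hsWeight p * s ^ 2 := by
    nlinarith [mul_nonneg hw (sq_nonneg (r - s))]
  rw [← Real.exp_add]
  have h2 := Real.exp_le_exp.2 h1
  have h3 : 1 ≤ Real.exp (2 * S.hsWeight p * r ^ 2 + 2 * S.hsWeight p * s ^ 2) :=
    Real.one_le_exp (by positivity)
  have h4 : 0 ≤ (S.fockNormSq (p + 3) f).toReal := ENNReal.toReal_nonneg
  unfold fockConst
  nlinarith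

lemma summable_tensorEval_cpt (hf : S.fockNormSq (p + 3) f < ∞) (q : E × E) :
    Summable fun k : Σ n : ℕ, (Fin n → ℕ) => ‖f k * ∏ j, S.cpt q (k.2 j)‖ :=
  Summable.of_nonneg_of_le (fun _ => norm_nonneg _)
    (norm_tensor_mul_prod_le f (S.norm_cpt_le q))
    (summable_majorant_and_tsum_le hf (add_nonneg (norm_nonneg _) (norm_nonneg _))).1

lemma tsum_norm_tensorEval_cpt_le (hf : S.fockNormSq (p + 3) f < ∞) (q : E × E) :
    ∑' k : Σ n : ℕ, (Fin n → ℕ), ‖f k * ∏ j, S.cpt q (k.2 j)‖ ≤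
      S.fockConst p f * (Real.exp (2 * S.hsWeight p * ‖q.1‖ ^ 2) *
        Real.exp (2 * S.hsWeight p * ‖q.2‖ ^ 2)) :=
  ((summable_tensorEval_cpt hf q).tsum_le_tsum (norm_tensor_mul_prod_le f (S.norm_cpt_le q))
    (summable_majorant_and_tsum_le hf (add_nonneg (norm_nonneg _) (norm_nonneg _))).1).trans
    (tsum_majorant_le hf (norm_nonneg _) (norm_nonneg _))

lemma norm_tensorEval_cpt_le (hf : S.fockNormSq (p + 3) f < ∞) (q : E × E) :
    ‖tensorEval f (S.cpt q)‖ ≤ S.fockConst p f * (Real.exp (2 * S.hsWeight p * ‖q.1‖ ^ 2) *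
        Real.exp (2 * S.hsWeight p * ‖q.2‖ ^ 2)) :=
  (norm_tsum_le_tsum_norm (summable_tensorEval_cpt hf q)).trans (tsum_norm_tensorEval_cpt_le hf q)

lemma continuous_tensorEval_cpt (hf : S.fockNormSq (p + 3) f < ∞) :
    Continuous fun q => tensorEval f (S.cpt q) := by
  refine continuous_iff_continuousAt.2 fun q₀ => ?_
  -- On this neighbourhood of q₀ one summable majorant serves all points, so the series converges
  -- uniformly there.
  set R := ‖q₀.1‖ + ‖q₀.2‖ + 1
  have hR : 0 ≤ R := by positivity
  have hU : IsOpen {q : E × E | ‖q.1‖ + ‖q.2‖ < R} := isOpen_lt (by fun_prop) continuous_const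
  refine ContinuousOn.continuousAt (s := {q : E × E | ‖q.1‖ + ‖q.2‖ < R}) ?_
    (hU.mem_nhds (lt_add_one (‖q₀.1‖ + ‖q₀.2‖)))
  refine continuousOn_tsum (fun k => Continuous.continuousOn ?_)
    (summable_majorant_and_tsum_le hf hR).1 fun k q hq => ?_
  · exact continuous_const.mul (continuous_finsetProd _ fun j _ => S.continuous_cpt _)
  · refine norm_tensor_mul_prod_le f (b := fun n => S.ev n ^ 2 * R) (fun n => (S.norm_cpt_le q n).trans ?_) k
    exact mul_le_mul_of_nonneg_left (le_of_lt hq) (sq_nonneg _)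

end WhiteNoise

/-! ### The continuous version of I f and its S-transform. -/

lemma integrable_exp_mul_norm_sq_of_le {E : Type*} [NormedAddCommGroup E] [MeasurableSpace E]
    [BorelSpace E] {γ : Measure E} {c c' : ℝ} (hc : c ≤ c')
    (h : Integrable (fun u => Real.exp (c' * ‖u‖ ^ 2)) γ) :
    Integrable (fun u => Real.exp (c * ‖u‖ ^ 2)) γ := by
  refine h.mono' (Continuous.aestronglyMeasurable (by fun_prop)) (ae_of_all _ fun u => ?_)
  rw [Real.norm_of_nonneg (Real.exp_nonneg _)]
  gcongr

lemma exp_mul_norm_add_sq_le {E : Type*} [NormedAddCommGroup E] [InnerProductSpace ℝ E]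
    {c : ℝ} (hc : 0 ≤ c) (u h : E) :
    Real.exp (c * ‖u + h‖ ^ 2) ≤ Real.exp (2 * c * ‖h‖ ^ 2) * Real.exp (2 * c * ‖u‖ ^ 2) := by
  rw [← Real.exp_add, Real.exp_le_exp]
  have h1 := parallelogram_law_with_norm ℝ u h
  nlinarith [mul_nonneg hc (sq_nonneg ‖u - h‖)]

namespace WhiteNoise

variable {E : Type*} [NormedAddCommGroup E] [InnerProductSpace ℝ E] {S : WhiteNoise E}

/-- A rotation of the pair (u, v) is multiplication of u + iv by a unit complex number; γ ⊗ γ is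
invariant under it. -/
lemma cpt_rotation (θ : ℝ) (q : E × E) (n : ℕ) :
    S.cpt (ContinuousLinearMap.rotation θ q) n = Complex.exp (-(θ * Complex.I)) * S.cpt q n := by
  rw [ContinuousLinearMap.rotation_apply, ← neg_mul, ← Complex.ofReal_neg, Complex.exp_mul_I,
    ← Complex.ofReal_cos, ← Complex.ofReal_sin, Real.cos_neg, Real.sin_neg]
  simp only [cpt, inner_add_right, inner_smul_right]
  push_cast
  linear_combination ((S.ev n : ℂ) ^ 2 * Complex.sin θ * (inner ℝ (S.e n) q.2 : ℝ)) *
    Complex.I_sq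

lemma cpt_add_invSq [CompleteSpace E] (x u v : E) (n : ℕ) :
    S.cpt (u + S.invSq x, v) n = S.cpt (u, v) n + S.coord x n := by
  have h := S.ev_pos n
  have h1 : (S.ev n : ℂ) ≠ 0 := by exact_mod_cast h.ne'
  simp only [cpt, coord, inner_add_right, inner_invSq]
  push_cast
  field_simp
  ring

variable [MeasurableSpace E] [BorelSpace E] {γ : Measure E} {p : ℕ} {f : Tensors}

/-- The bound for the translates of the entire function defined by `f` is integrable. -/
lemma integrable_bound_add (hw : Integrable (fun u => Real.exp (4 * S.hsWeight p * ‖u‖ ^ 2)) γ)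
    (h : E) : Integrable (fun q : E × E => S.fockConst p f *
      (Real.exp (2 * S.hsWeight p * ‖q.1 + h‖ ^ 2) * Real.exp (2 * S.hsWeight p * ‖q.2‖ ^ 2)))
      (γ.prod γ) := by
  have h0 := S.hsWeight_nonneg p
  refine Integrable.const_mul (Integrable.mul_prod
    (f := fun u => Real.exp (2 * S.hsWeight p * ‖u + h‖ ^ 2))
    (g := fun v => Real.exp (2 * S.hsWeight p * ‖v‖ ^ 2)) ?_
    (integrable_exp_mul_norm_sq_of_le (by linarith) hw)) _
  refine (hw.const_mul (Real.exp (4 * S.hsWeight p * ‖h‖ ^ 2))).mono'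
    (Continuous.aestronglyMeasurable (by fun_prop)) (ae_of_all _ fun u => ?_)
  rw [Real.norm_of_nonneg (Real.exp_nonneg _)]
  refine (exp_mul_norm_add_sq_le (by linarith) u h).trans (le_of_eq ?_)
  ring_nf

/-- The continuous version of `I f`, as a function on `H₋₂`, identified with `H₀`. -/
def chaosVersion (S : WhiteNoise E) (γ : Measure E) (f : Tensors) (u : E) : ℂ :=
  ∫ v, tensorEval f (S.cpt (u, v)) ∂γ

lemma norm_chaosVersion_le (hw : Integrable (fun u => Real.exp (4 * S.hsWeight p * ‖u‖ ^ 2)) γ)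
    (hf : S.fockNormSq (p + 3) f < ∞) (u : E) :
    ‖S.chaosVersion γ f u‖ ≤ (S.fockConst p f * ∫ v, Real.exp (2 * S.hsWeight p * ‖v‖ ^ 2) ∂γ) *
      Real.exp (2 * S.hsWeight p * ‖u‖ ^ 2) := by
  have h0 := S.hsWeight_nonneg p
  have h1 := integrable_exp_mul_norm_sq_of_le (c := 2 * S.hsWeight p) (by linarith) hw
  refine (norm_integral_le_of_norm_le ((h1.const_mul (Real.exp (2 * S.hsWeight p * ‖u‖ ^ 2))).const_mul
    (S.fockConst p f))
    (ae_of_all _ fun v => norm_tensorEval_cpt_le hf (u, v))).trans (le_of_eq ?_)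
  rw [integral_const_mul, integral_const_mul]
  ring

lemma continuous_chaosVersion
    (hw : Integrable (fun u => Real.exp (4 * S.hsWeight p * ‖u‖ ^ 2)) γ)
    (hf : S.fockNormSq (p + 3) f < ∞) : Continuous (S.chaosVersion γ f) := by
  have h0 := S.hsWeight_nonneg p
  have h1 := integrable_exp_mul_norm_sq_of_le (c := 2 * S.hsWeight p) (by linarith) hw
  have hc := continuous_tensorEval_cpt hf
  refine continuous_iff_continuousAt.2 fun u₀ => ?_
  refine continuousAt_of_dominated (bound := fun v => S.fockConst p f *
    (Real.exp (2 * S.hsWeight p * (‖u₀‖ + 1) ^ 2) * Real.exp (2 * S.hsWeight p * ‖v‖ ^ 2)))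
    (Eventually.of_forall fun u => (hc.comp (by fun_prop)).aestronglyMeasurable) ?_
    ((h1.const_mul _).const_mul _) (ae_of_all _ fun v => (hc.comp (by fun_prop)).continuousAt)
  have h2 : ∀ᶠ u in 𝓝 u₀, ‖u‖ < ‖u₀‖ + 1 :=
    continuous_norm.continuousAt.eventually_lt_const (lt_add_one _)
  filter_upwards [h2] with u hu
  refine ae_of_all _ fun v => (norm_tensorEval_cpt_le hf (u, v)).trans ?_
  have := fockConst_nonneg (S := S) (p := p) (f := f)
  gcongr

variable [CompleteSpace E] [IsProbabilityMeasure γ]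

lemma integrable_prod_cpt [SecondCountableTopology E]
    (hγ : ∀ t, charFun γ t = Complex.exp (-(‖S.invSq t‖ ^ 2 : ℝ) / 2)) {n : ℕ}
    (i : Fin n → ℕ) (s : Finset (Fin n)) :
    Integrable (fun q => ∏ j ∈ s, S.cpt q (i j)) (γ.prod γ) := by
  have := isGaussian_of_charFun_eq hγ
  have h1 : Integrable (fun q : E × E => ‖q‖ ^ s.card) (γ.prod γ) :=
    (IsGaussian.memLp_id (γ.prod γ) s.card (by simp)).integrable_norm_pow'
  refine (h1.const_mul (∏ j ∈ s, (S.ev (i j) ^ 2 * 2))).mono'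
    (continuous_finsetProd _ fun j _ => S.continuous_cpt _).aestronglyMeasurable
    (ae_of_all _ fun q => ?_)
  rw [norm_prod, ← Finset.prod_const, ← Finset.prod_mul_distrib]
  refine Finset.prod_le_prod (fun _ _ => norm_nonneg _) fun j _ => (S.norm_cpt_le q _).trans ?_
  rw [mul_assoc]
  refine mul_le_mul_of_nonneg_left ?_ (sq_nonneg _)
  linarith [norm_fst_le q, norm_snd_le q]

/-- The complex Gaussian moments without conjugates vanish. -/
lemma integral_prod_cpt_eq_zero [SecondCountableTopology E]
    (hγ : ∀ t, charFun γ t = Complex.exp (-(‖S.invSq t‖ ^ 2 : ℝ) / 2)) {n : ℕ}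
    (i : Fin n → ℕ) {s : Finset (Fin n)} (hs : s.Nonempty) :
    ∫ q, ∏ j ∈ s, S.cpt q (i j) ∂γ.prod γ = 0 := by
  -- For this angle a product of |s| coordinates picks up the factor e^{-iπ} = -1, so its integral
  -- equals its own negative.
  set θ : ℝ := Real.pi / s.card
  have hc : (s.card : ℂ) ≠ 0 := by exact_mod_cast hs.card_ne_zero
  have h1 := map_rotation_eq_of_charFun_eq hγ θ
  have h2 : ∫ q, ∏ j ∈ s, S.cpt q (i j) ∂γ.prod γ = -∫ q, ∏ j ∈ s, S.cpt q (i j) ∂γ.prod γ := by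
    conv_lhs => rw [← h1]
    rw [integral_map (by fun_prop)
      (continuous_finsetProd _ fun j _ => S.continuous_cpt _).aestronglyMeasurable,
      ← integral_neg]
    refine integral_congr_ae (ae_of_all _ fun q => ?_)
    simp only [cpt_rotation, Finset.prod_mul_distrib, Finset.prod_const]
    rw [← Complex.exp_nat_mul]
    have h3 : (s.card : ℂ) * -(θ * Complex.I) = -(Real.pi * Complex.I) := by
      simp only [θ]
      push_cast
      field_simp
    rw [h3, Complex.exp_neg, Complex.exp_pi_mul_I]
    norm_num
  exact self_eq_neg.1 h2

/-- Expand the product over the subsets of factors taken from u + iv: only the empty subset has a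
nonzero integral. -/
lemma integral_prod_cpt_add [SecondCountableTopology E]
    (hγ : ∀ t, charFun γ t = Complex.exp (-(‖S.invSq t‖ ^ 2 : ℝ) / 2)) (x : E) {n : ℕ}
    (i : Fin n → ℕ) :
    ∫ q : E × E, ∏ j, S.cpt (q.1 + S.invSq x, q.2) (i j) ∂γ.prod γ = ∏ j, S.coord x (i j) := by
  classical
  simp only [cpt_add_invSq, Finset.prod_add]
  rw [integral_finsetSum _ fun s _ => (integrable_prod_cpt hγ i s).mul_const _,
    Finset.sum_eq_single_of_mem ∅ (Finset.empty_mem_powerset _) fun s _ hs => by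
      rw [integral_mul_const, integral_prod_cpt_eq_zero hγ i (Finset.nonempty_iff_ne_empty.2 hs),
        zero_mul]]
  simp

lemma integral_tensorEval_cpt_add [SecondCountableTopology E]
    (hγ : ∀ t, charFun γ t = Complex.exp (-(‖S.invSq t‖ ^ 2 : ℝ) / 2))
    (hw : Integrable (fun u => Real.exp (4 * S.hsWeight p * ‖u‖ ^ 2)) γ)
    (hf : S.fockNormSq (p + 3) f < ∞) (x : E) :
    ∫ q : E × E, tensorEval f (S.cpt (q.1 + S.invSq x, q.2)) ∂γ.prod γ =
      tensorEval f (S.coord x) := by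
  have hc (k : Σ n : ℕ, (Fin n → ℕ)) :
      Continuous fun q : E × E => f k * ∏ j, S.cpt (q.1 + S.invSq x, q.2) (k.2 j) :=
    continuous_const.mul (continuous_finsetProd _ fun j _ =>
      (S.continuous_cpt _).comp (by fun_prop))
  unfold tensorEval
  rw [integral_tsum fun k => (hc k).aestronglyMeasurable]
  · simp_rw [integral_const_mul, integral_prod_cpt_add hγ]
  · rw [← lintegral_tsum fun k => (hc k).aestronglyMeasurable.enorm]
    refine ((lintegral_mono fun q => ?_).trans_lt
      (integrable_bound_add (f := f) hw (S.invSq x)).lintegral_lt_top).ne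
    refine le_trans ?_ (ENNReal.ofReal_le_ofReal
      (tsum_norm_tensorEval_cpt_le hf (q.1 + S.invSq x, q.2)))
    rw [ENNReal.ofReal_tsum_of_nonneg (fun _ => norm_nonneg _) (summable_tensorEval_cpt hf _)]
    exact le_of_eq (tsum_congr fun k => (ofReal_norm _).symm)

/-- The `S`-transform of the continuous version of `I f`. -/
theorem integral_chaosVersion_mul_expFun [SecondCountableTopology E]
    (hγ : ∀ t, charFun γ t = Complex.exp (-(‖S.invSq t‖ ^ 2 : ℝ) / 2))
    (hw : Integrable (fun u => Real.exp (4 * S.hsWeight p * ‖u‖ ^ 2)) γ)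
    (hf : S.fockNormSq (p + 3) f < ∞) (x : S.Nucl) :
    ∫ u, S.chaosVersion γ f u * S.expFun x (S.emb u) ∂γ = tensorEval f (S.coord (S.incl x)) := by
  -- For t = A² x the Cameron–Martin density is the renormalized exponential of x, and the shift is
  -- A⁻² x.
  have hcm := map_add_eq_withDensity hγ (S.powA 2 x)
  rw [invSq_powA, adjoint_invSq] at hcm
  calc _ = ∫ u, S.chaosVersion γ f u ∂(γ.withDensity fun u =>
        ENNReal.ofReal (Real.exp (inner ℝ u (S.powA 2 x) - ‖S.incl x‖ ^ 2 / 2))) := by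
        rw [integral_withDensity_eq_integral_toReal_smul (by fun_prop) (by simp)]
        refine integral_congr_ae (ae_of_all _ fun u => ?_)
        simp only [ENNReal.toReal_ofReal (Real.exp_nonneg _), expFun, emb_apply,
          Complex.real_smul, Complex.ofReal_exp, mul_comm]
    _ = ∫ u, S.chaosVersion γ f (u + S.invSq (S.incl x)) ∂γ := by
        rw [← hcm, integral_map (by fun_prop)
          (continuous_chaosVersion hw hf).aestronglyMeasurable]
    _ = ∫ q : E × E, tensorEval f (S.cpt (q.1 + S.invSq (S.incl x), q.2)) ∂γ.prod γ := by
        rw [integral_prod]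
        · rfl
        refine (integrable_bound_add (f := f) hw (S.invSq (S.incl x))).mono'
          ((continuous_tensorEval_cpt hf).comp (by fun_prop)).aestronglyMeasurable
          (ae_of_all _ fun q => norm_tensorEval_cpt_le hf _)
    _ = _ := integral_tensorEval_cpt_add hγ hw hf _

end WhiteNoise

/-! ### Identification of φ with its continuous version on H₋₂. -/

namespace WhiteNoise

variable {E : Type*} [NormedAddCommGroup E] [InnerProductSpace ℝ E] [CompleteSpace E]
  {S : WhiteNoise E} [MeasurableSpace E] [BorelSpace E] {γ : Measure E} [IsProbabilityMeasure γ]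

lemma ae_eq_zero_of_integral_mul_expFun
    (hγ : ∀ t, charFun γ t = Complex.exp (-(‖S.invSq t‖ ^ 2 : ℝ) / 2))
    {H : E → ℂ} (hH : MemLp H 2 γ) (h0 : ∀ y, ∫ u, H u * S.expFun y (S.emb u) ∂γ = 0) :
    H =ᵐ[γ] 0 := by
  have := S.secondCountableTopology
  have h1 (y : S.Nucl) : ∫ u, H u * (Real.exp (inner ℝ u (S.powA 2 y)) : ℝ) ∂γ = 0 := by
    have h2 := h0 y
    simp_rw [expFun_emb, Complex.ofReal_mul, ← mul_assoc] at h2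
    rw [integral_mul_const] at h2
    exact (mul_eq_zero.1 h2).resolve_right (by exact_mod_cast (Real.exp_pos _).ne')
  have hi (y : S.Nucl) : Integrable (fun u => H u * (Real.exp (inner ℝ u (S.powA 2 y)) : ℝ)) γ :=
    hH.integrable_mul (memLp_exp_inner hγ (S.powA 2 y)).ofReal
  have hre : (fun u => (H u).re) =ᵐ[γ] 0 := by
    refine ae_eq_zero_of_integral_mul_exp_inner hγ _ S.dense_range_powA hH.re ?_
    rintro _ ⟨y, rfl⟩
    have h3 := integral_re (hi y)
    rw [h1] at h3
    simpa [-Complex.ofReal_exp] using h3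
  have him : (fun u => (H u).im) =ᵐ[γ] 0 := by
    refine ae_eq_zero_of_integral_mul_exp_inner hγ _ S.dense_range_powA hH.im ?_
    rintro _ ⟨y, rfl⟩
    have h3 := integral_im (hi y)
    rw [h1] at h3
    simpa [-Complex.ofReal_exp] using h3
  filter_upwards [hre, him] with u h3 h4
  exact Complex.ext h3 h4

variable {p : ℕ} {f : Tensors}

/-- A continuous representative of `I f` agrees with `chaosVersion` on `H₋₂`. -/
theorem comp_emb_eq_chaosVersion
    (hγ : ∀ t, charFun γ t = Complex.exp (-(‖S.invSq t‖ ^ 2 : ℝ) / 2))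
    (hμ : S.gaussian = γ.map S.emb)
    (hw : Integrable (fun u => Real.exp (4 * S.hsWeight p * ‖u‖ ^ 2)) γ)
    (hf : S.fockNormSq (p + 3) f < ∞) {φ : S.Dual → ℂ} (hφ : Continuous φ)
    (hI : S.IsWienerIto f φ) (u : E) : φ (S.emb u) = S.chaosVersion γ f u := by
  have := S.secondCountableTopology
  have hc1 : Continuous fun u => φ (S.emb u) := hφ.comp S.continuous_emb
  have hc2 := continuous_chaosVersion hw hf
  have hL1 : MemLp (fun u => φ (S.emb u)) 2 γ := by
    have := hI.2.1
    rw [hμ] at this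
    exact this.comp_measurePreserving ⟨S.measurable_emb, rfl⟩
  -- Squaring the bound doubles its exponent 2 w_p, which is where the 4 in `hw` comes from.
  have hL2 : MemLp (S.chaosVersion γ f) 2 γ := by
    set M := S.fockConst p f * ∫ v, Real.exp (2 * S.hsWeight p * ‖v‖ ^ 2) ∂γ
    refine (memLp_two_iff_integrable_sq_norm hc2.aestronglyMeasurable).2
      ((hw.const_mul (M ^ 2)).mono' (by fun_prop) (ae_of_all _ fun u => ?_))
    rw [Real.norm_of_nonneg (sq_nonneg _)]
    refine (pow_le_pow_left₀ (norm_nonneg _) (norm_chaosVersion_le hw hf u) 2).trans (le_of_eq ?_)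
    rw [mul_pow, ← Real.exp_nat_mul]
    congr 2
    push_cast
    ring
  have hG (y : S.Nucl) := memLp_expFun_emb hγ y
  have hae := ae_eq_zero_of_integral_mul_expFun hγ (hL1.sub hL2) fun y => by
    have h1 : Integrable (fun u => φ (S.emb u) * S.expFun y (S.emb u)) γ :=
      hL1.integrable_mul (hG y)
    have h2 : Integrable (fun u => S.chaosVersion γ f u * S.expFun y (S.emb u)) γ :=
      hL2.integrable_mul (hG y)
    simp only [Pi.sub_apply, sub_mul]
    rw [integral_sub h1 h2, integral_mul_expFun_of_isWienerIto hγ hμ hI,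
      integral_chaosVersion_mul_expFun hγ hw hf, sub_self]
  have hopen : IsOpen {u | φ (S.emb u) ≠ S.chaosVersion γ f u} := isOpen_ne_fun hc1 hc2
  -- The set where two continuous functions differ is open. Being null, it is empty, as γ has full
  -- support.
  have hempty := eq_empty_of_isOpen_of_measure_eq_zero hγ S.denseRange_adjoint_invSq hopen <| by
    refine ae_iff.1 ?_
    filter_upwards [hae] with u hu
    exact sub_eq_zero.1 hu
  by_contra hne
  exact (Set.eq_empty_iff_forall_notMem.1 hempty) u hne

end WhiteNoise

end

theorem theoremT {E : Type*} [NormedAddCommGroup E] [InnerProductSpace ℝ E] [CompleteSpace E]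
    (S : WhiteNoise E) (V : Submodule ℝ E) (a : E) (ha : a ∈ Vᗮ) :
    (∃! μ : Measure S.Dual, S.IsWhiteNoiseMeasure μ) ∧
    (∃! ν : Measure S.Dual, S.IsAffineGaussian a V ν) ∧
    (∃! ν : Measure S.Dual, S.IsAffineGaussian 0 V ν) ∧
    ∀ φ ∈ S.testFunctions,
      Integrable φ (S.affineGaussian a V) ∧
      Integrable (fun x => φ (x + S.toDual a)) (S.affineGaussian 0 V) ∧
      ∫ x, φ x ∂(S.affineGaussian a V) = ∫ x, φ (x + S.toDual a) ∂(S.affineGaussian 0 V) := by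
  refine ⟨S.existsUnique_isWhiteNoiseMeasure, S.existsUnique_isAffineGaussian a V,
    S.existsUnique_isAffineGaussian 0 V, fun φ hφ => ?_⟩
  borelize E
  have := S.secondCountableTopology
  obtain ⟨γ, _, hγ, hμ⟩ := S.exists_gaussian_eq_map
  obtain ⟨γV, _, hγV⟩ := S.exists_gaussian_charFun_eq V
  have := isGaussian_of_charFun_eq hγ
  have := isGaussian_of_charFun_eq hγV
  -- Fernique's theorem is needed for both measures: γ integrates out the imaginary direction in
  -- `chaosVersion`, and φ is integrated against γV. The next choice of p makes 4 w_p at most both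
  -- constants.
  obtain ⟨C, hC, hCi⟩ := ProbabilityTheory.IsGaussian.exists_integrable_exp_sq γ
  obtain ⟨C', hC', hCi'⟩ := ProbabilityTheory.IsGaussian.exists_integrable_exp_sq γV
  obtain ⟨p, hp⟩ := S.exists_hsWeight_le (c := min C C' / 4) (by positivity)
  have hw := integrable_exp_mul_norm_sq_of_le (c := 4 * S.hsWeight p)
    (by linarith [min_le_left C C']) hCi
  have hwV := integrable_exp_mul_norm_sq_of_le (c := 4 * S.hsWeight p)
    (by linarith [min_le_right C C']) hCi'
  obtain ⟨f, hf, hI⟩ := hφ.2 (p + 3)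
  have hrep := WhiteNoise.comp_emb_eq_chaosVersion hγ hμ hw hf.2 hφ.1 hI
  set b := S.invSq a
  have hembed : MeasurableEmbedding fun u => S.emb (u + b) :=
    S.measurableEmbedding_emb.comp (measurableEmbedding_addRight b)
  have heq : S.affineGaussian a V = γV.map fun u => S.emb (u + b) := S.affineGaussian_eq hγV a
  have heq0 : S.affineGaussian 0 V = γV.map S.emb := by
    simpa using S.affineGaussian_eq hγV 0
  have hshift (u : E) : S.emb u + S.toDual a = S.emb (u + b) := by
    rw [S.emb_add, S.emb_invSq]
  have hint : Integrable (fun u => φ (S.emb (u + b))) γV := by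
    -- Equality at every point is essential here, because γV need not be absolutely continuous with
    -- respect to γ.
    simp only [hrep]
    have h0 := S.hsWeight_nonneg p
    set M := S.fockConst p f * ∫ v, Real.exp (2 * S.hsWeight p * ‖v‖ ^ 2) ∂γ
    have hM : 0 ≤ M := mul_nonneg WhiteNoise.fockConst_nonneg (integral_nonneg fun _ => Real.exp_nonneg _)
    refine ((hwV.const_mul (Real.exp (4 * S.hsWeight p * ‖b‖ ^ 2))).const_mul M).mono'
      ((WhiteNoise.continuous_chaosVersion hw hf.2).comp (by fun_prop)).aestronglyMeasurable
      (ae_of_all _ fun u => (WhiteNoise.norm_chaosVersion_le hw hf.2 _).trans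
        (mul_le_mul_of_nonneg_left ?_ hM))
    refine (exp_mul_norm_add_sq_le (by linarith) u b).trans (le_of_eq ?_)
    ring_nf
  rw [heq, heq0, hembed.integrable_map_iff, S.measurableEmbedding_emb.integrable_map_iff,
    hembed.integral_map, S.measurableEmbedding_emb.integral_map]
  simp only [Function.comp_def, hshift]
  exact ⟨hint, hint, trivial⟩
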